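/- Let $\overline{\mathbb Q}\subset\mathbb C$ be the field of algebraic numbers and $\Gamma=\mathrm{Gal}(\overline{\mathbb Q}/\mathbb Q)$. A (clean) Belyi polynomial is a polynomial $f$ of degree at least $3$ whose critical values in $\mathbb C$ lie in $\{0,1\}$ and whose local degree at every point of $f^{-1}(1)$ is exactly $2$. It is extra-clean dynamical if moreover its postcritical set $\overline{\bigcup_{n>0} f^{\circ n}(\{c\in\mathbb C : f'(c)=0\})}$ is contained in $\{0,1\}$, $f(0)=f(1)=0$, and $f$ has local degree $1$ at $0$ and at $1$. The dessin $\mathbf D_f$ is the planar tree $f^{-1}([0,1])$, with black vertices $f^{-1}(0)$, white vertices $f^{-1}(1)$, and open edges the connected components of $f^{-1}((0,1))$. Two dessins are isomorphic, $\mathbf D_f\simeq\mathbf D_g$, if there are bijections between their black vertices, white vertices and edges that preserve incidence and the counterclockwise cyclic order of the edges around each vertex. Let $BP$ (resp. $XDBP$) be the set of clean Belyi polynomials (resp. extra-clean dynamical Belyi polynomials) in $\overline{\mathbb Q}[z]$. Let $[BP]$ be the set of isomorphism classes $[f]$ of elements of $BP$, where $f,g$ are isomorphic if $f=g\circ A$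 for some affine map $A(z)=az+b$ with $a,b\in\mathbb C$, $a\ne 0$. The group $\Gamma$ acts on $BP$ and on $XDBP$ by acting on coefficients, and this induces an action on $[BP]$. **Theorem.** (1) If $f,g\in\mathbb C[z]$ are extra-clean dynamical Belyi polynomials, then so is $f\circ g$; in particular $XDBP$ is closed under composition. (2) If $f,g\in\mathbb C[z]$ are extra-clean dynamical Belyi polynomials (in particular, if $f,g\in XDBP$), then $$\mathbf D_{f\circ f}\simeq\mathbf D_{g\circ g}\iff f=g.$$ (3) The map $XDBP\to[BP]$, $f\mapsto[f\circ f]$, is injective and $\Gamma$-equivariant. -/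

import Mathlib

namespace BelyiDessin

open Polynomial Topology Filter

/-! ### Complex polynomials as branched covers and as dynamical systems -/

/-- The local degree (ramification index) of the polynomial map `f` at `z`. -/
noncomputable def localDegree (f : ℂ[X]) (z : ℂ) : ℕ :=
  (f - C (f.eval z)).rootMultiplicity z

/-- The set of critical points in the plane. -/
def criticalPoints (f : ℂ[X]) : Set ℂ := {c | f.derivative.eval c = 0}

/-- The set of finite critical values. -/
def criticalValues (f : ℂ[X]) : Set ℂ := (fun z => f.eval z) '' criticalPoints f

/-- The closure of the union of all forward images `f^n (C_f)`, `n > 0`. -/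
def postcriticalSet (f : ℂ[X]) : Set ℂ :=
  closure (⋃ (n : ℕ) (_ : 0 < n), (fun z => f.eval z)^[n] '' criticalPoints f)

/-- A clean Belyi polynomial (of degree at least three): the critical values lie in `{0, 1}`
and the ramification at every point over `1` is exactly two. -/
structure IsBelyi (f : ℂ[X]) : Prop where
  three_le_natDegree : 3 ≤ f.natDegree
  criticalValues_subset : criticalValues f ⊆ {0, 1}
  clean : ∀ z : ℂ, f.eval z = 1 → localDegree f z = 2

/-- A dynamical Belyi polynomial. -/
structure IsDynamicalBelyi (f : ℂ[X]) : Prop extends IsBelyi f where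
  postcriticalSet_subset : postcriticalSet f ⊆ {0, 1}

/-- An extra-clean dynamical Belyi polynomial. -/
structure IsExtraClean (f : ℂ[X]) : Prop extends IsDynamicalBelyi f where
  eval_zero : f.eval 0 = 0
  eval_one : f.eval 1 = 0
  localDegree_zero : localDegree f 0 = 1
  localDegree_one : localDegree f 1 = 1

/-- `f = g ∘ A` for some affine automorphism `A` of the complex plane. -/
def AffineIso (f g : ℂ[X]) : Prop :=
  ∃ a b : ℂ, a ≠ 0 ∧ f = g.comp (C a * X + C b)

/-! ### Dessins -/

/-- A bicolored graph drawn in the oriented plane: black and white vertices, and the open edges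
as subsets of the plane. -/
structure PlaneDrawing where
  black : Set ℂ
  white : Set ℂ
  edges : Set (Set ℂ)

namespace PlaneDrawing

/-- All points of the drawing: the vertices and the points on the edges. -/
def support (D : PlaneDrawing) : Set ℂ := D.black ∪ D.white ∪ ⋃₀ D.edges

/-- `v` is an end point of the open edge `e`. -/
def Incident (v : ℂ) (e : Set ℂ) : Prop := v ∈ closure e

/-- `e'` is the edge that follows `e` counterclockwise around the vertex `v`: on all small circles
around `v`, some counterclockwise arc (at most a full turn) leads from a point of `e` to a point
of `e'` without meeting the drawing in between. At a vertex with a single edge `e`, the edge `e`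
follows itself. -/
def CcwNext (D : PlaneDrawing) (v : ℂ) (e e' : Set ℂ) : Prop :=
  ∀ᶠ r in 𝓝[>] (0 : ℝ), ∃ θ θ' : ℝ, θ < θ' ∧ θ' ≤ θ + 2 * Real.pi ∧
    circleMap v r θ ∈ e ∧ circleMap v r θ' ∈ e' ∧
    ∀ t ∈ Set.Ioo θ θ', circleMap v r t ∉ D.support

/-- An orientation- and color-preserving isomorphism of cell structures: bijections of black
vertices, white vertices and edges that respect incidence and the counterclockwise order of the
edges around each vertex. (The drawings below are trees, with a single 2-cell, so there is nothing
more to say about 2-cells.) -/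
structure Iso (D D' : PlaneDrawing) where
  onBlack : D.black ≃ D'.black
  onWhite : D.white ≃ D'.white
  onEdges : D.edges ≃ D'.edges
  incident_black : ∀ (v : D.black) (e : D.edges),
    Incident (v : ℂ) (e : Set ℂ) ↔ Incident (onBlack v : ℂ) (onEdges e : Set ℂ)
  incident_white : ∀ (v : D.white) (e : D.edges),
    Incident (v : ℂ) (e : Set ℂ) ↔ Incident (onWhite v : ℂ) (onEdges e : Set ℂ)
  ccw_black : ∀ (v : D.black) (e e' : D.edges),
    D.CcwNext v e e' ↔ D'.CcwNext (onBlack v) (onEdges e) (onEdges e')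
  ccw_white : ∀ (v : D.white) (e e' : D.edges),
    D.CcwNext v e e' ↔ D'.CcwNext (onWhite v) (onEdges e) (onEdges e')

/-- Isomorphism of drawings. -/
def Isomorphic (D D' : PlaneDrawing) : Prop := Nonempty (Iso D D')

end PlaneDrawing

/-- The preimage under `f` of the open segment from `0` to `1`. -/
def openSegmentPreimage (f : ℂ[X]) : Set ℂ := {z | ∃ t ∈ Set.Ioo (0 : ℝ) 1, f.eval z = (t : ℂ)}

/-- The dessin of `f`: the preimage of the segment `[0, 1]`, with the preimages of `0` as black
vertices, the preimages of `1` as white vertices, and the connected components of the preimage of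
the open segment as open edges. -/
def dessin (f : ℂ[X]) : PlaneDrawing where
  black := {z | f.eval z = 0}
  white := {z | f.eval z = 1}
  edges := {e | ∃ z ∈ openSegmentPreimage f, e = connectedComponentIn (openSegmentPreimage f) z}

/-! ### Polynomials with algebraic coefficients and the Galois action -/

/-- The field of algebraic numbers inside `ℂ`. -/
noncomputable abbrev Qbar : IntermediateField ℚ ℂ := algebraicClosure ℚ ℂ

/-- The absolute Galois group of `ℚ`. -/
abbrev AbsGal : Type := Qbar ≃ₐ[ℚ] Qbar

/-- A polynomial with algebraic coefficients, seen as a complex polynomial. -/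
noncomputable def toC (f : Qbar[X]) : ℂ[X] := f.map (algebraMap Qbar ℂ)

/-- The twist of `f` by `σ`: apply `σ` to all coefficients. -/
noncomputable def twist (σ : AbsGal) (f : Qbar[X]) : Qbar[X] := f.map (σ : Qbar →+* Qbar)

theorem toC_injective : Function.Injective toC :=
  Polynomial.map_injective _ (algebraMap Qbar ℂ).injective

theorem toC_comp (f g : Qbar[X]) : toC (f.comp g) = (toC f).comp (toC g) :=
  Polynomial.map_comp _ _ _

theorem twist_comp (σ : AbsGal) (f g : Qbar[X]) :
    twist σ (f.comp g) = (twist σ f).comp (twist σ g) :=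
  Polynomial.map_comp _ _ _

theorem twist_one (f : Qbar[X]) : twist 1 f = f := by
  ext n; simp [twist]

theorem twist_mul (σ τ : AbsGal) (f : Qbar[X]) : twist (σ * τ) f = twist σ (twist τ f) := by
  ext n; simp [twist]

theorem eval_toC (f : Qbar[X]) (w : Qbar) : (toC f).eval (w : ℂ) = ((f.eval w : Qbar) : ℂ) :=
  Polynomial.eval_map_apply (algebraMap Qbar ℂ) w

theorem eval_twist (σ : AbsGal) (f : Qbar[X]) (w : Qbar) :
    (twist σ f).eval (σ w) = σ (f.eval w) :=
  Polynomial.eval_map_apply (σ : Qbar →+* Qbar) w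

theorem derivative_toC (f : Qbar[X]) : (toC f).derivative = toC f.derivative :=
  Polynomial.derivative_map _ _

theorem derivative_twist (σ : AbsGal) (f : Qbar[X]) :
    (twist σ f).derivative = twist σ f.derivative :=
  Polynomial.derivative_map _ _

theorem natDegree_toC (f : Qbar[X]) : (toC f).natDegree = f.natDegree :=
  Polynomial.natDegree_map_eq_of_injective (algebraMap Qbar ℂ).injective _

theorem natDegree_twist (σ : AbsGal) (f : Qbar[X]) : (twist σ f).natDegree = f.natDegree :=
  Polynomial.natDegree_map_eq_of_injective σ.injective _

theorem localDegree_toC (f : Qbar[X]) (w : Qbar) :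
    localDegree (toC f) (w : ℂ) = (f - C (f.eval w)).rootMultiplicity w := by
  rw [localDegree, eval_toC,
    Polynomial.eq_rootMultiplicity_map (p := f - C (f.eval w)) (algebraMap Qbar ℂ).injective w]
  simp [toC]

theorem localDegree_twist (σ : AbsGal) (f : Qbar[X]) (w : Qbar) :
    localDegree (toC (twist σ f)) ((σ w : Qbar) : ℂ) = localDegree (toC f) (w : ℂ) := by
  rw [localDegree_toC, localDegree_toC, eval_twist,
    Polynomial.eq_rootMultiplicity_map (p := f - C (f.eval w))
      (f := (σ : Qbar →+* Qbar)) σ.injective w]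
  simp [twist]

theorem exists_of_eval_eq_zero {p : Qbar[X]} (hp : p ≠ 0) {z : ℂ} (hz : (toC p).eval z = 0) :
    ∃ w : Qbar, (w : ℂ) = z := by
  have h : IsAlgebraic Qbar z := ⟨p, hp, by
    rw [Polynomial.aeval_def, ← Polynomial.eval_map]; exact hz⟩
  have : Algebra.IsAlgebraic ℚ Qbar := algebraicClosure.isAlgebraic ℚ ℂ
  have h' : IsAlgebraic ℚ z := h.restrictScalars ℚ
  exact ⟨⟨z, mem_algebraicClosure_iff.2 h'⟩, rfl⟩

theorem exists_of_eval_eq {p : Qbar[X]} (hp : 0 < p.natDegree) {z : ℂ} {c : Qbar}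
    (hz : (toC p).eval z = (c : ℂ)) : ∃ w : Qbar, (w : ℂ) = z := by
  refine exists_of_eval_eq_zero (p := p - C c) (fun h => ?_) ?_
  · rw [sub_eq_zero.1 h, natDegree_C] at hp
    exact lt_irrefl _ hp
  · simp only [toC, Polynomial.map_sub, Polynomial.map_C, eval_sub, eval_C]
    exact sub_eq_zero.2 hz

theorem exists_of_mem_criticalPoints {f : Qbar[X]} (hf : 0 < f.natDegree) {z : ℂ}
    (hz : z ∈ criticalPoints (toC f)) : ∃ w : Qbar, (w : ℂ) = z := by
  refine exists_of_eval_eq_zero (p := f.derivative) (fun h => ?_) ?_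
  · exact hf.ne' (Polynomial.derivative_eq_zero.1 h)
  · rw [← derivative_toC]; exact hz

theorem mem_criticalPoints_toC (f : Qbar[X]) (w : Qbar) :
    (w : ℂ) ∈ criticalPoints (toC f) ↔ f.derivative.eval w = 0 := by
  change (toC f).derivative.eval (w : ℂ) = 0 ↔ _
  rw [derivative_toC, eval_toC]
  exact_mod_cast Iff.rfl

theorem mem_criticalPoints_twist (σ : AbsGal) (f : Qbar[X]) (w : Qbar) :
    ((σ w : Qbar) : ℂ) ∈ criticalPoints (toC (twist σ f)) ↔ (w : ℂ) ∈ criticalPoints (toC f) := by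
  rw [mem_criticalPoints_toC, mem_criticalPoints_toC, derivative_twist, eval_twist]
  simp

theorem iterate_toC (f : Qbar[X]) (n : ℕ) (w : Qbar) :
    (fun z => (toC f).eval z)^[n] (w : ℂ) = (((fun z => f.eval z)^[n] w : Qbar) : ℂ) := by
  induction n generalizing w with
  | zero => rfl
  | succ n ih => rw [Function.iterate_succ_apply, Function.iterate_succ_apply, eval_toC, ih]

theorem iterate_twist (σ : AbsGal) (f : Qbar[X]) (n : ℕ) (w : Qbar) :
    (fun z => (twist σ f).eval z)^[n] (σ w) = σ ((fun z => f.eval z)^[n] w) := by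
  induction n generalizing w with
  | zero => rfl
  | succ n ih => rw [Function.iterate_succ_apply, Function.iterate_succ_apply, eval_twist, ih]

theorem coe_mem_pair (σ : AbsGal) (x : Qbar) (h : (x : ℂ) ∈ ({0, 1} : Set ℂ)) :
    ((σ x : Qbar) : ℂ) ∈ ({0, 1} : Set ℂ) := by
  rcases h with h | h
  · have : x = 0 := by exact_mod_cast h
    simp [this]
  · have : x = 1 := by
      have h1 : (x : ℂ) = 1 := h
      exact_mod_cast h1
    simp [this]

theorem IsBelyi.twist {f : Qbar[X]} (hf : IsBelyi (toC f)) (σ : AbsGal) :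
    IsBelyi (toC (twist σ f)) := by
  have hd : 3 ≤ f.natDegree := by simpa only [natDegree_toC] using hf.three_le_natDegree
  have hd' : 0 < (BelyiDessin.twist σ f).natDegree := by rw [natDegree_twist]; omega
  refine ⟨by rw [natDegree_toC, natDegree_twist]; exact hd, ?_, ?_⟩
  · rintro _ ⟨z, hz, rfl⟩
    obtain ⟨w', rfl⟩ := exists_of_mem_criticalPoints hd' hz
    obtain ⟨w, rfl⟩ := σ.surjective w'
    have := hf.criticalValues_subset ⟨_, (mem_criticalPoints_twist σ f w).1 hz, rfl⟩
    simp only [eval_toC, eval_twist] at this ⊢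
    exact coe_mem_pair σ _ this
  · intro z hz
    obtain ⟨w', rfl⟩ := exists_of_eval_eq (c := 1) hd' (by simpa using hz)
    obtain ⟨w, rfl⟩ := σ.surjective w'
    rw [localDegree_twist]
    refine hf.clean _ ?_
    rw [eval_toC, eval_twist] at hz
    rw [eval_toC]
    have h1 : σ (f.eval w) = 1 := by exact_mod_cast hz
    have h2 : f.eval w = 1 := σ.injective (by rw [h1, map_one])
    simp [h2]

theorem postcriticalSet_subset_iff (f : ℂ[X]) : postcriticalSet f ⊆ {0, 1} ↔
    ∀ n : ℕ, 0 < n → ∀ c ∈ criticalPoints f,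
      (fun z => f.eval z)^[n] c ∈ ({0, 1} : Set ℂ) := by
  have hc : IsClosed ({0, 1} : Set ℂ) := (Set.toFinite _).isClosed
  rw [postcriticalSet, hc.closure_subset_iff]
  simp only [Set.iUnion_subset_iff, Set.image_subset_iff]
  exact Iff.rfl

theorem IsDynamicalBelyi.twist {f : Qbar[X]} (hf : IsDynamicalBelyi (toC f)) (σ : AbsGal) :
    IsDynamicalBelyi (toC (twist σ f)) := by
  have hd : 3 ≤ f.natDegree := by simpa only [natDegree_toC] using hf.three_le_natDegree
  have hd' : 0 < (BelyiDessin.twist σ f).natDegree := by rw [natDegree_twist]; omega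
  refine ⟨hf.toIsBelyi.twist σ, (postcriticalSet_subset_iff _).2 fun n hn z hz => ?_⟩
  obtain ⟨w', rfl⟩ := exists_of_mem_criticalPoints hd' hz
  obtain ⟨w, rfl⟩ := σ.surjective w'
  have := (postcriticalSet_subset_iff _).1 hf.postcriticalSet_subset n hn _
    ((mem_criticalPoints_twist σ f w).1 hz)
  rw [iterate_toC] at this ⊢
  rw [iterate_twist]
  exact coe_mem_pair σ _ this

theorem IsExtraClean.twist {f : Qbar[X]} (hf : IsExtraClean (toC f)) (σ : AbsGal) :
    IsExtraClean (toC (twist σ f)) := by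
  have key : ∀ w : Qbar, σ w = w → (toC f).eval (w : ℂ) = 0 →
      (toC (BelyiDessin.twist σ f)).eval (w : ℂ) = 0 := by
    intro w hw h
    have h0 : f.eval w = 0 := by rw [eval_toC] at h; exact_mod_cast h
    rw [← hw, eval_toC, eval_twist, h0]; simp
  have h0 := localDegree_twist σ f 0
  have h1 := localDegree_twist σ f 1
  have e0 := key 0 (map_zero σ)
  have e1 := key 1 (map_one σ)
  simp only [map_zero, map_one, ZeroMemClass.coe_zero, OneMemClass.coe_one] at h0 h1 e0 e1
  exact ⟨hf.toIsDynamicalBelyi.twist σ, e0 hf.eval_zero, e1 hf.eval_one,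
    h0.trans hf.localDegree_zero, h1.trans hf.localDegree_one⟩

/-- An affine map that relates two nonconstant polynomials with algebraic coefficients has
algebraic coefficients itself. -/
theorem AffineIso.algebraic {f g : Qbar[X]} (hf : 0 < f.natDegree) (hg : 0 < g.natDegree)
    (h : AffineIso (toC f) (toC g)) :
    ∃ a b : Qbar, a ≠ 0 ∧ f = g.comp (C a * X + C b) := by
  obtain ⟨a, b, ha, hfg⟩ := h
  have hv : ∀ c : Qbar, ∃ z w : Qbar, f.eval z = c ∧ (w : ℂ) = a * z + b := by
    intro c
    obtain ⟨z', hz'⟩ := IsAlgClosed.exists_root (toC f - C (c : ℂ)) (by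
      have hd : (toC f - C (c : ℂ)).natDegree = f.natDegree := by
        rw [natDegree_sub_C, natDegree_toC]
      intro h0
      rw [natDegree_eq_of_degree_eq_some h0] at hd
      exact hf.ne hd)
    have hz : (toC f).eval z' = (c : ℂ) := by
      simpa [sub_eq_zero] using hz'
    obtain ⟨z, rfl⟩ := exists_of_eval_eq hf hz
    have hgz : (toC g).eval (a * z + b) = (c : ℂ) := by
      rw [← hz, hfg]; simp
    obtain ⟨w, hw⟩ := exists_of_eval_eq hg hgz
    exact ⟨z, w, by rw [eval_toC] at hz; exact_mod_cast hz, hw⟩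
  obtain ⟨z₀, w₀, h₀, k₀⟩ := hv 0
  obtain ⟨z₁, w₁, h₁, k₁⟩ := hv 1
  have hne : z₁ - z₀ ≠ 0 := by
    intro h
    rw [sub_eq_zero.1 h, h₀] at h₁
    exact zero_ne_one h₁
  have hneC : (z₁ : ℂ) - z₀ ≠ 0 := by exact_mod_cast hne
  have hA : (((w₁ - w₀) / (z₁ - z₀) : Qbar) : ℂ) = a := by
    push_cast
    rw [k₀, k₁]
    field_simp
    ring
  have hB : ((w₀ - (w₁ - w₀) / (z₁ - z₀) * z₀ : Qbar) : ℂ) = b := by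
    rw [show ((w₀ - (w₁ - w₀) / (z₁ - z₀) * z₀ : Qbar) : ℂ)
      = w₀ - (((w₁ - w₀) / (z₁ - z₀) : Qbar) : ℂ) * z₀ by push_cast; ring, hA, k₀]
    ring
  refine ⟨(w₁ - w₀) / (z₁ - z₀), w₀ - (w₁ - w₀) / (z₁ - z₀) * z₀, fun h0 => ha ?_,
    toC_injective ?_⟩
  · rw [← hA, h0]; simp
  · have hL : toC (C ((w₁ - w₀) / (z₁ - z₀)) * X + C (w₀ - (w₁ - w₀) / (z₁ - z₀) * z₀))
        = C a * X + C b := by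
      rw [← hA, ← hB]
      simp only [toC, Polynomial.map_add, Polynomial.map_mul, Polynomial.map_C, Polynomial.map_X]
      rfl
    rw [toC_comp, hL, hfg]

theorem AffineIso.refl (f : ℂ[X]) : AffineIso f f := ⟨1, 0, one_ne_zero, by simp⟩

theorem AffineIso.symm {f g : ℂ[X]} (h : AffineIso f g) : AffineIso g f := by
  obtain ⟨a, b, ha, rfl⟩ := h
  refine ⟨a⁻¹, -(a⁻¹ * b), inv_ne_zero ha, ?_⟩
  rw [Polynomial.comp_assoc]
  have : (C a * X + C b : ℂ[X]).comp (C a⁻¹ * X + C (-(a⁻¹ * b))) = X := by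
    simp only [add_comp, mul_comp, C_comp, X_comp, mul_add, ← mul_assoc, ← C_mul]
    rw [mul_inv_cancel₀ ha, add_assoc, ← C_add]
    have : a * -(a⁻¹ * b) + b = 0 := by field_simp; ring
    rw [this]; simp
  rw [this, comp_X]

theorem AffineIso.trans {f g h : ℂ[X]} (h₁ : AffineIso f g) (h₂ : AffineIso g h) :
    AffineIso f h := by
  obtain ⟨a, b, ha, rfl⟩ := h₁
  obtain ⟨c, d, hc, rfl⟩ := h₂
  refine ⟨c * a, c * b + d, mul_ne_zero hc ha, ?_⟩
  rw [Polynomial.comp_assoc]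
  congr 1
  simp only [add_comp, mul_comp, C_comp, X_comp, C_mul, C_add]
  ring

/-- The set `BP` of clean Belyi polynomials with algebraic coefficients. -/
def BP : Type := {f : Qbar[X] // IsBelyi (toC f)}

/-- The set `XDBP` of extra-clean dynamical Belyi polynomials with algebraic coefficients. -/
def XDBP : Type := {f : Qbar[X] // IsExtraClean (toC f)}

/-- The Galois group acts on `BP` by twisting coefficients. -/
noncomputable instance : MulAction AbsGal BP where
  smul σ f := ⟨twist σ f.1, f.2.twist σ⟩
  one_smul f := Subtype.ext (twist_one f.1)
  mul_smul σ τ f := Subtype.ext (twist_mul σ τ f.1)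

/-- The Galois group acts on `XDBP` by twisting coefficients. -/
noncomputable instance : MulAction AbsGal XDBP where
  smul σ f := ⟨twist σ f.1, f.2.twist σ⟩
  one_smul f := Subtype.ext (twist_one f.1)
  mul_smul σ τ f := Subtype.ext (twist_mul σ τ f.1)

/-- Isomorphism of Belyi polynomials: affine change of coordinate in the domain. -/
instance bpSetoid : Setoid BP where
  r f g := AffineIso (toC f.1) (toC g.1)
  iseqv := ⟨fun _ => AffineIso.refl _, AffineIso.symm, AffineIso.trans⟩

/-- The set `[BP]` of isomorphism classes of clean Belyi polynomials. -/
def BPClass : Type := Quotient bpSetoid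

theorem smul_congr (σ : AbsGal) (f g : BP) (h : f ≈ g) : σ • f ≈ σ • g := by
  have hd : ∀ k : BP, 0 < k.1.natDegree := fun k => by
    have := k.2.three_le_natDegree
    rw [natDegree_toC] at this
    omega
  obtain ⟨a, b, ha, hab⟩ := AffineIso.algebraic (hd f) (hd g) h
  refine ⟨((σ a : Qbar) : ℂ), ((σ b : Qbar) : ℂ), ?_, ?_⟩
  · have : σ a ≠ 0 := by simpa using ha
    exact_mod_cast this
  · change toC (twist σ f.1) = (toC (twist σ g.1)).comp _
    rw [hab, twist_comp, toC_comp]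
    congr 1
    simp only [twist, toC, Polynomial.map_add, Polynomial.map_mul, Polynomial.map_C,
      Polynomial.map_X]
    rfl

/-- The action of the Galois group on `[BP]` induced by twisting coefficients. -/
noncomputable instance : MulAction AbsGal BPClass where
  smul σ := Quotient.map (fun f => σ • f) (smul_congr σ)
  one_smul := by
    rintro ⟨f⟩
    exact congrArg (Quotient.mk bpSetoid) (one_smul AbsGal f)
  mul_smul σ τ := by
    rintro ⟨f⟩
    exact congrArg (Quotient.mk bpSetoid) (mul_smul σ τ f)

/-- The map `XDBP → [BP]`, `f ↦ [f ∘ f]`; that `f ∘ f` is a clean Belyi polynomial comes from the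
closure of the extra-clean polynomials under composition. -/
noncomputable def secondIterateClass
    (hcomp : ∀ f g : ℂ[X], IsExtraClean f → IsExtraClean g → IsExtraClean (f.comp g))
    (f : XDBP) : BPClass :=
  Quotient.mk bpSetoid ⟨f.1.comp f.1, by
    rw [toC_comp]
    exact (hcomp _ _ f.2 f.2).toIsBelyi⟩

end BelyiDessin

/-!
Local degrees multiply under composition, which gives closure. If `f ∘ f = g ∘ (g ∘ A)` with `A`
affine, then `f = B ∘ g ∘ A` for some affine `B`, because decompositions with factors of given
degrees are unique up to affine maps. Comparing ramification over `0` and `1` shows `B = id`, so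
`f ∘ f = g ∘ f` and `f = g`.

A dessin determines its polynomial up to affine maps. Over the plane slit along `(-∞, 0]` and
`[1, ∞)` a polynomial `F` with critical values in `{0, 1}` is a disjoint union of sheets, one for
each edge of its dessin, and the sheets are glued across the slits according to the counterclockwise
order of the edges around black and white vertices. An isomorphism of dessins therefore yields a map
`Φ` with `G ∘ Φ = F` that is holomorphic off a finite set. It is bounded near that set, hence
extends to an entire function, and it grows linearly because `F` and `G` have the same degree, hence
is affine.
-/

namespace BelyiDessin

open Polynomial Topology Filter

/-! ### Local degrees and composition -/

section Multiplicity

variable {R : Type*} [CommRing R]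

theorem sub_C_ne_zero {p : R[X]} (hp : 0 < p.natDegree) (c : R) : p - C c ≠ 0 :=
  ne_zero_of_natDegree_gt (n := 0) (by rwa [natDegree_sub_C])

theorem rootMultiplicity_pow [IsDomain R] (p : R[X]) (n : ℕ) (x : R) :
    (p ^ n).rootMultiplicity x = n * p.rootMultiplicity x := by
  classical rw [← count_roots, roots_pow, Multiset.count_nsmul, count_roots]

theorem rootMultiplicity_comp [IsDomain R] (p q : R[X]) (x : R) :
    (p.comp q).rootMultiplicity x
      = p.rootMultiplicity (q.eval x) * (q - C (q.eval x)).rootMultiplicity x := by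
  rcases eq_or_ne p 0 with rfl | hp
  · simp
  rcases eq_or_ne (q - C (q.eval x)) 0 with hq | hq
  · rw [hq, sub_eq_zero.1 hq, comp_C, rootMultiplicity_C, rootMultiplicity_zero, mul_zero]
  obtain ⟨r, hpr, hr⟩ := exists_eq_pow_rootMultiplicity_mul_and_not_dvd p hp (q.eval x)
  have hrx : ¬ (r.comp q).IsRoot x := by
    rwa [dvd_iff_isRoot, IsRoot.def, ← eval_comp] at hr
  have hr0 : r.comp q ≠ 0 := fun h => hrx (by simp [h])
  have hcomp : p.comp q = (q - C (q.eval x)) ^ p.rootMultiplicity (q.eval x) * r.comp q := by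
    conv_lhs => rw [hpr]
    simp
  rw [hcomp, rootMultiplicity_mul (mul_ne_zero (pow_ne_zero _ hq) hr0), rootMultiplicity_pow,
    rootMultiplicity_eq_zero hrx, add_zero]

end Multiplicity

section LocalDegree

variable {f g : ℂ[X]} {z : ℂ}

theorem localDegree_comp (f g : ℂ[X]) (z : ℂ) :
    localDegree (f.comp g) z = localDegree f (g.eval z) * localDegree g z := by
  have h := rootMultiplicity_comp (f - C (f.eval (g.eval z))) g z
  rw [sub_comp, C_comp] at h
  rwa [localDegree, eval_comp]

theorem localDegree_pos (hf : 0 < f.natDegree) : 0 < localDegree f z :=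
  (rootMultiplicity_pos (sub_C_ne_zero hf _)).2 (by simp)

theorem localDegree_linear {a : ℂ} (ha : a ≠ 0) (b z : ℂ) : localDegree (C a * X + C b) z = 1 := by
  have h : (C a * X + C b : ℂ[X]) - C ((C a * X + C b : ℂ[X]).eval z) = C a * (X - C z) := by
    simp; ring
  rw [localDegree, h, rootMultiplicity_mul (mul_ne_zero (C_ne_zero.2 ha) (X_sub_C_ne_zero z)),
    rootMultiplicity_C, rootMultiplicity_X_sub_C_self, zero_add]

theorem rootMultiplicity_derivative (f : ℂ[X]) (z : ℂ) :
    f.derivative.rootMultiplicity z = localDegree f z - 1 := by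
  simpa [localDegree] using derivative_rootMultiplicity_of_root (p := f - C (f.eval z)) (t := z)

theorem localDegree_eq_one_iff (hf : 0 < f.natDegree) :
    localDegree f z = 1 ↔ z ∉ criticalPoints f := by
  have hf' : f.derivative ≠ 0 := fun h => hf.ne' (derivative_eq_zero.1 h)
  have hpos := localDegree_pos (z := z) hf
  have hcrit : z ∈ criticalPoints f ↔ 0 < f.derivative.rootMultiplicity z :=
    (rootMultiplicity_pos hf').symm
  rw [hcrit, rootMultiplicity_derivative]
  omega

theorem mem_criticalPoints_comp :
    z ∈ criticalPoints (f.comp g) ↔ z ∈ criticalPoints g ∨ g.eval z ∈ criticalPoints f := by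
  simp [criticalPoints, derivative_comp]

theorem eval_mem_criticalValues (hz : z ∈ criticalPoints f) : f.eval z ∈ criticalValues f :=
  Set.mem_image_of_mem _ hz

theorem IsBelyi.natDegree_pos (hf : IsBelyi f) : 0 < f.natDegree :=
  three_pos.trans_le hf.three_le_natDegree

theorem IsBelyi.mem_criticalPoints_of_eval_eq_one (hf : IsBelyi f) (hz : f.eval z = 1) :
    z ∈ criticalPoints f := by
  by_contra h
  have h1 := (localDegree_eq_one_iff hf.natDegree_pos).2 h
  rw [hf.clean z hz] at h1
  exact absurd h1 (by norm_num)

theorem IsExtraClean.eval_of_mem_pair (hf : IsExtraClean f) (hz : z ∈ ({0, 1} : Set ℂ)) :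
    f.eval z = 0 := by
  rcases hz with rfl | rfl
  exacts [hf.eval_zero, hf.eval_one]

theorem IsExtraClean.eval_comp_eq_zero (hf : IsExtraClean f) (hg : IsExtraClean g)
    (hz : z ∈ criticalPoints g) : f.eval (g.eval z) = 0 :=
  hf.eval_of_mem_pair (hg.criticalValues_subset (eval_mem_criticalValues hz))

theorem postcriticalSet_subset_of_mapsTo (hf : criticalValues f ⊆ {0, 1})
    (hmaps : Set.MapsTo f.eval {0, 1} {0, 1}) : postcriticalSet f ⊆ {0, 1} := by
  refine (postcriticalSet_subset_iff f).2 fun n hn c hc => ?_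
  obtain ⟨k, rfl⟩ := Nat.exists_eq_succ_of_ne_zero hn.ne'
  exact hmaps.iterate k (hf (eval_mem_criticalValues hc))

theorem IsExtraClean.criticalValues_comp_subset (hf : IsExtraClean f) (hg : IsExtraClean g) :
    criticalValues (f.comp g) ⊆ {0, 1} := by
  rintro _ ⟨z, hz, rfl⟩
  simp only [eval_comp]
  rcases mem_criticalPoints_comp.1 hz with hz | hz
  · exact Or.inl (hf.eval_comp_eq_zero hg hz)
  · exact hf.criticalValues_subset (eval_mem_criticalValues hz)

theorem IsExtraClean.comp (hf : IsExtraClean f) (hg : IsExtraClean g) :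
    IsExtraClean (f.comp g) := by
  have hmap : ∀ z ∈ ({0, 1} : Set ℂ), (f.comp g).eval z = 0 := fun z hz => by
    rw [eval_comp, hg.eval_of_mem_pair hz, hf.eval_zero]
  refine { three_le_natDegree := ?_
           criticalValues_subset := hf.criticalValues_comp_subset hg
           clean := fun z hz => ?_
           postcriticalSet_subset := postcriticalSet_subset_of_mapsTo
             (hf.criticalValues_comp_subset hg) fun z hz => Or.inl (hmap z hz)
           eval_zero := hmap 0 (by simp)
           eval_one := hmap 1 (by simp)
           localDegree_zero := ?_
           localDegree_one := ?_ }
  · rw [natDegree_comp]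
    exact hf.three_le_natDegree.trans (Nat.le_mul_of_pos_right _ hg.natDegree_pos)
  · rw [eval_comp] at hz
    have hcrit : z ∉ criticalPoints g := fun h =>
      zero_ne_one ((hf.eval_comp_eq_zero hg h).symm.trans hz)
    rw [localDegree_comp, hf.clean _ hz, (localDegree_eq_one_iff hg.natDegree_pos).2 hcrit]
  · rw [localDegree_comp, hg.eval_zero, hf.localDegree_zero, hg.localDegree_zero]
  · rw [localDegree_comp, hg.eval_one, hf.localDegree_zero, hg.localDegree_one]

end LocalDegree

/-! ### Uniqueness of polynomial decompositions -/

section Decomposition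

theorem comp_eq_leadingCoeff_mul_pow_add {R : Type*} [CommSemiring R] (p q : R[X]) :
    p.comp q = C p.leadingCoeff * q ^ p.natDegree + p.eraseLead.comp q := by
  conv_lhs => rw [← eraseLead_add_C_mul_X_pow p]
  rw [add_comp, mul_comp, C_comp, X_pow_comp, add_comm]

theorem natDegree_eraseLead_comp_le {R : Type*} [Semiring R] (p q : R[X]) :
    (p.eraseLead.comp q).natDegree ≤ (p.natDegree - 1) * q.natDegree :=
  natDegree_comp_le.trans (Nat.mul_le_mul_right _ (eraseLead_natDegree_le p))

variable {R : Type*} [CommRing R] [IsDomain R] {f g u v : R[X]}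

theorem eq_of_comp_eq (hu : 0 < u.natDegree) (h : f.comp u = g.comp u) : f = g := by
  have h0 : (f - g).comp u = 0 := by rw [sub_comp, h, sub_self]
  rcases comp_eq_zero_iff.1 h0 with hfg | ⟨-, hconst⟩
  · exact sub_eq_zero.1 hfg
  · rw [hconst, natDegree_C] at hu
    exact absurd hu (lt_irrefl 0)

theorem coeff_geom_sum₂ (hdeg : u.natDegree = v.natDegree)
    (hlead : u.leadingCoeff = v.leadingCoeff) (n : ℕ) :
    (∑ i ∈ Finset.range n, u ^ i * v ^ (n - 1 - i)).coeff ((n - 1) * u.natDegree)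
      = n * u.leadingCoeff ^ (n - 1) := by
  have hterm : ∀ i ∈ Finset.range n,
      (u ^ i * v ^ (n - 1 - i)).coeff ((n - 1) * u.natDegree) = u.leadingCoeff ^ (n - 1) := by
    intro i hi
    have hi : i + (n - 1 - i) = n - 1 := Nat.add_sub_cancel' (by grind)
    have hexp : (n - 1) * u.natDegree = (u ^ i).natDegree + (v ^ (n - 1 - i)).natDegree := by
      rw [natDegree_pow, natDegree_pow, ← hdeg, ← add_mul, hi]
    rw [hexp, coeff_mul_degree_add_degree, leadingCoeff_pow, leadingCoeff_pow, ← hlead, ← pow_add,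
      hi]
  rw [finsetSum_coeff, Finset.sum_congr rfl hterm, Finset.sum_const, Finset.card_range,
    nsmul_eq_mul]

theorem le_natDegree_pow_sub_pow (hdeg : u.natDegree = v.natDegree)
    (hlead : u.leadingCoeff = v.leadingCoeff) (huv : u ≠ v) {n : ℕ} (hn : (n : R) ≠ 0) :
    (n - 1) * u.natDegree + (u - v).natDegree ≤ (u ^ n - v ^ n).natDegree := by
  have hu : u.leadingCoeff ≠ 0 := fun hu =>
    huv ((leadingCoeff_eq_zero.1 hu).trans (leadingCoeff_eq_zero.1 (hlead ▸ hu)).symm)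
  have hcoeff := coeff_geom_sum₂ hdeg hlead n ▸ mul_ne_zero hn (pow_ne_zero (n - 1) hu)
  rw [← (Commute.all u v).geom_sum₂_mul,
    natDegree_mul (fun h => hcoeff (by rw [h, coeff_zero])) (sub_ne_zero.2 huv)]
  exact Nat.add_le_add_right (le_natDegree_of_ne_zero hcoeff) _

theorem leadingCoeff_eq_of_comp_eq (hfg : f.natDegree = g.natDegree) (hu : 0 < u.natDegree)
    (hdeg : u.natDegree = v.natDegree) (hlead : u.leadingCoeff = v.leadingCoeff)
    (h : f.comp u = g.comp v) : f.leadingCoeff = g.leadingCoeff := by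
  have h' := congrArg leadingCoeff h
  rw [leadingCoeff_comp hu.ne', leadingCoeff_comp (hdeg ▸ hu.ne'), ← hfg, ← hlead] at h'
  exact mul_right_cancel₀
    (pow_ne_zero _ (leadingCoeff_ne_zero.2 (ne_zero_of_natDegree_gt hu))) h'

theorem natDegree_sub_eq_zero_of_comp_eq (hf : (f.natDegree : R) ≠ 0)
    (hfg : f.natDegree = g.natDegree) (hdeg : u.natDegree = v.natDegree)
    (hlead : u.leadingCoeff = v.leadingCoeff) (h : f.comp u = g.comp v) :
    (u - v).natDegree = 0 := by
  by_contra hne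
  have huv : u ≠ v := fun huv => hne (by rw [huv, sub_self, natDegree_zero])
  have hu : 0 < u.natDegree := by
    have := natDegree_sub_le u v
    rw [← hdeg, max_self] at this
    omega
  have hf0 : f.leadingCoeff ≠ 0 := by
    rw [leadingCoeff_ne_zero]
    rintro rfl
    simp at hf
  have hdiff : C f.leadingCoeff * (u ^ f.natDegree - v ^ f.natDegree)
      = g.eraseLead.comp v - f.eraseLead.comp u := by
    have hfg' := leadingCoeff_eq_of_comp_eq hfg hu hdeg hlead h
    rw [comp_eq_leadingCoeff_mul_pow_add, comp_eq_leadingCoeff_mul_pow_add g, ← hfg, ← hfg'] at h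
    linear_combination h
  have hupper : (u ^ f.natDegree - v ^ f.natDegree).natDegree
      ≤ (f.natDegree - 1) * u.natDegree := by
    rw [← natDegree_C_mul hf0, hdiff]
    refine (natDegree_sub_le _ _).trans (max_le ?_ (natDegree_eraseLead_comp_le f u))
    rw [hfg, hdeg]
    exact natDegree_eraseLead_comp_le g v
  have hlower := le_natDegree_pow_sub_pow hdeg hlead huv hf
  omega

theorem exists_affine_of_comp_eq {K : Type*} [Field K] {f g u w : K[X]}
    (hf : (f.natDegree : K) ≠ 0) (hfg : f.natDegree = g.natDegree) (hu : 0 < u.natDegree)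
    (huw : u.natDegree = w.natDegree) (h : f.comp u = g.comp w) :
    ∃ a b : K, a ≠ 0 ∧ u = C a * w + C b := by
  have hu0 : u.leadingCoeff ≠ 0 := leadingCoeff_ne_zero.2 (ne_zero_of_natDegree_gt hu)
  have hw0 : w.leadingCoeff ≠ 0 := leadingCoeff_ne_zero.2 (ne_zero_of_natDegree_gt (huw ▸ hu))
  set a := u.leadingCoeff / w.leadingCoeff
  have ha : a ≠ 0 := div_ne_zero hu0 hw0
  have hg : (g.comp (C a⁻¹ * X)).comp (C a * w) = g.comp w := by
    rw [comp_assoc, mul_comp, C_comp, X_comp, ← mul_assoc, ← C_mul, inv_mul_cancel₀ ha, C_1,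
      one_mul]
  have hconst : (u - C a * w).natDegree = 0 := by
    refine natDegree_sub_eq_zero_of_comp_eq hf (g := g.comp (C a⁻¹ * X)) ?_ ?_ ?_ (h.trans hg.symm)
    · rw [natDegree_comp, natDegree_C_mul_X _ (inv_ne_zero ha), mul_one, hfg]
    · rw [natDegree_C_mul ha, huw]
    · rw [leadingCoeff_mul, leadingCoeff_C, div_mul_cancel₀ _ hw0]
  obtain ⟨b, hb⟩ := natDegree_eq_zero.1 hconst
  exact ⟨a, b, ha, by rw [hb, add_sub_cancel]⟩

end Decomposition

/-! ### Extra-clean polynomials are determined by their second iterates -/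

section Rigidity

variable {f g : ℂ[X]}

theorem IsBelyi.one_mem_criticalValues (hf : IsBelyi f) : 1 ∈ criticalValues f := by
  obtain ⟨z, hz⟩ := IsAlgClosed.eval_surjective hf.natDegree_pos.ne' 1
  exact ⟨z, hf.mem_criticalPoints_of_eval_eq_one hz, hz⟩

-- Otherwise all `n - 1` critical points lie over `1`, which has only `n / 2` preimages.
theorem IsBelyi.zero_mem_criticalValues (hf : IsBelyi f) : 0 ∈ criticalValues f := by
  by_contra h0
  have hle : f.derivative.roots + f.derivative.roots ≤ (f - C 1).roots := by
    refine Multiset.le_iff_count.2 fun z => ?_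
    rw [Multiset.count_add, count_roots, count_roots, rootMultiplicity_derivative]
    by_cases hz : z ∈ criticalPoints f
    · have hz1 : f.eval z = 1 :=
        (hf.criticalValues_subset (eval_mem_criticalValues hz)).resolve_left fun h => h0 ⟨z, hz, h⟩
      have h2 := hf.clean z hz1
      rw [h2]
      rw [localDegree, hz1] at h2
      omega
    · simp [(localDegree_eq_one_iff hf.natDegree_pos).2 hz]
  have hcard := Multiset.card_le_card hle
  rw [Multiset.card_add, ← (IsAlgClosed.splits f.derivative).natDegree_eq_card_roots,
    ← (IsAlgClosed.splits (f - C 1)).natDegree_eq_card_roots, natDegree_sub_C,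
    natDegree_derivative] at hcard
  have := hf.three_le_natDegree
  omega

theorem localDegree_affine_comp_comp {a b c d : ℂ} (ha : a ≠ 0) (hc : c ≠ 0) (z : ℂ) :
    localDegree (C a * g.comp (C c * X + C d) + C b) z = localDegree g (c * z + d) := by
  have h : C a * g.comp (C c * X + C d) + C b
      = (C a * X + C b : ℂ[X]).comp (g.comp (C c * X + C d)) := by simp
  rw [h, localDegree_comp, localDegree_comp, localDegree_linear ha, localDegree_linear hc]
  simp

theorem IsExtraClean.eq_comp_of_eq_affine_comp (hf : IsExtraClean f) (hg : IsExtraClean g)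
    {a b c d : ℂ} (ha : a ≠ 0) (hc : c ≠ 0)
    (h : f = C a * g.comp (C c * X + C d) + C b) : f = g.comp (C c * X + C d) := by
  have hlocal : ∀ z, localDegree f z = localDegree g (c * z + d) := fun z => by
    rw [h, localDegree_affine_comp_comp ha hc]
  have hval : ∀ y, ∃ z, c * z + d = y ∧ f.eval z = a * g.eval y + b := fun y =>
    ⟨(y - d) / c, by field_simp; ring, by
      rw [h]; simp [mul_div_cancel₀ (y - d) hc]⟩
  have hcrit : ∀ y ∈ criticalValues g, a * y + b ∈ ({0, 1} : Set ℂ) := by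
    rintro _ ⟨y, hy, rfl⟩
    obtain ⟨z, hzy, hz⟩ := hval y
    have hzf : z ∈ criticalPoints f := by
      by_contra hz'
      rw [← localDegree_eq_one_iff hf.natDegree_pos, hlocal, hzy,
        localDegree_eq_one_iff hg.natDegree_pos] at hz'
      exact hz' hy
    exact hz ▸ hf.criticalValues_subset (eval_mem_criticalValues hzf)
  -- If `b = 1`, then `f` would be unramified at a preimage of `1`, as `g` is at `0`.
  have hb : b = 0 := by
    refine (by simpa using hcrit 0 hg.zero_mem_criticalValues : b = 0 ∨ b = 1).resolve_right
      fun hb => ?_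
    obtain ⟨z, hz0, hz⟩ := hval 0
    have h2 := hf.clean z (by rw [hz, hg.eval_zero, hb]; ring)
    rw [hlocal, hz0, hg.localDegree_zero] at h2
    exact absurd h2 (by norm_num)
  have ha1 : a = 1 := by simpa [hb, ha] using hcrit 1 hg.one_mem_criticalValues
  rw [h, hb, ha1, C_1, one_mul, C_0, add_zero]

theorem IsExtraClean.eq_of_affineIso (hf : IsExtraClean f) (hg : IsExtraClean g)
    (h : AffineIso (f.comp f) (g.comp g)) : f = g := by
  obtain ⟨c, d, hc, h⟩ := h
  have hL : (C c * X + C d : ℂ[X]).natDegree = 1 := natDegree_linear hc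
  have hdeg : f.natDegree = g.natDegree := by
    have := congrArg natDegree h
    rw [natDegree_comp, natDegree_comp, natDegree_comp, hL, mul_one] at this
    exact Nat.mul_self_inj.1 this
  rw [comp_assoc] at h
  obtain ⟨a, b, ha, hab⟩ := exists_affine_of_comp_eq (Nat.cast_ne_zero.2 hf.natDegree_pos.ne') hdeg
    hf.natDegree_pos (by rw [natDegree_comp, hL, mul_one, hdeg]) h
  rw [← hf.eq_comp_of_eq_affine_comp hg ha hc hab] at h
  exact eq_of_comp_eq hf.natDegree_pos h

end Rigidity

/-! ### Branches of the inverse of a polynomial -/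

section Branches

theorem eqOn_of_isCoveringMapOn {A E B : Type*} [TopologicalSpace A] [TopologicalSpace E]
    [TopologicalSpace B] {p : E → B} {S : Set B} (hp : IsCoveringMapOn p S) {K : Set A}
    (hK : IsPreconnected K) {g₁ g₂ : A → E} (h₁ : ContinuousOn g₁ K) (h₂ : ContinuousOn g₂ K)
    (he : ∀ a ∈ K, p (g₁ a) = p (g₂ a)) (hS : ∀ a ∈ K, p (g₁ a) ∈ S) {a : A} (ha : a ∈ K)
    (hag : g₁ a = g₂ a) : Set.EqOn g₁ g₂ K := by
  have : PreconnectedSpace K := isPreconnected_iff_preconnectedSpace.1 hK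
  rw [continuousOn_iff_continuous_domRestrict] at h₁ h₂
  let k₁ : K → p ⁻¹' S := fun x => ⟨g₁ x, hS x x.2⟩
  let k₂ : K → p ⁻¹' S := fun x => ⟨g₂ x, Set.mem_preimage.2 (he x x.2 ▸ hS x x.2)⟩
  have hk : k₁ = k₂ := hp.isCoveringMap_restrictPreimage.eq_of_comp_eq (h₁.subtype_mk _)
    (h₂.subtype_mk _) (funext fun x => Subtype.ext (he x x.2)) ⟨a, ha⟩ (Subtype.ext hag)
  exact fun x hx => congrArg Subtype.val (congrFun hk ⟨x, hx⟩)

/-- The regular values of the polynomial map `F`: over them it is a covering map. -/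
abbrev regularValues (F : ℂ[X]) : Set ℂ := (criticalValues F)ᶜ

/-- `s` is a continuous branch of the inverse of `F` over `T`; its values outside `T` are
arbitrary. -/
structure IsBranch (F : ℂ[X]) (T : Set ℂ) (s : ℂ → ℂ) : Prop where
  continuousOn : ContinuousOn s T
  eval_apply : ∀ w ∈ T, F.eval (s w) = w

variable {F : ℂ[X]} {T : Set ℂ} {s : ℂ → ℂ}

theorem IsBranch.mono {T' : Set ℂ} (hs : IsBranch F T s) (hT : T' ⊆ T) : IsBranch F T' s :=
  ⟨hs.continuousOn.mono hT, fun w hw => hs.eval_apply w (hT hw)⟩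

theorem IsBranch.eqOn {s' : ℂ → ℂ} (hs : IsBranch F T s) (hs' : IsBranch F T s')
    (hT : IsPreconnected T) (hr : T ⊆ regularValues F) {w : ℂ} (hw : w ∈ T) (h : s w = s' w) :
    Set.EqOn s s' T :=
  eqOn_of_isCoveringMapOn F.isCoveringMapOn_eval hT hs.continuousOn hs'.continuousOn
    (fun a ha => by rw [hs.eval_apply a ha, hs'.eval_apply a ha])
    (fun a ha => by rw [hs.eval_apply a ha]; exact hr ha) hw h

theorem IsBranch.apply_eval (hs : IsBranch F T s) (hr : T ⊆ regularValues F) {K : Set ℂ}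
    (hK : IsPreconnected K) (hKT : Set.MapsTo F.eval K T) {z : ℂ} (hz : z ∈ K)
    (hsz : s (F.eval z) = z) {y : ℂ} (hy : y ∈ K) : s (F.eval y) = y :=
  eqOn_of_isCoveringMapOn F.isCoveringMapOn_eval hK (g₁ := fun y => s (F.eval y))
    (hs.continuousOn.comp F.continuous.continuousOn hKT) continuousOn_id
    (fun _ ha => hs.eval_apply _ (hKT ha))
    (fun _ ha => by rw [hs.eval_apply _ (hKT ha)]; exact hr (hKT ha)) hz hsz hy

theorem IsBranch.eventually_apply_eval (hs : IsBranch F T s) (hT : IsOpen T)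
    (hr : T ⊆ regularValues F) {z : ℂ} (hz : F.eval z ∈ T) (hsz : s (F.eval z) = z) :
    ∀ᶠ y in 𝓝 z, F.eval y ∈ T ∧ s (F.eval y) = y := by
  obtain ⟨ε, hε, hball⟩ := Metric.isOpen_iff.1 (hT.preimage F.continuous) z hz
  filter_upwards [Metric.ball_mem_nhds z hε] with y hy
  exact ⟨hball hy, hs.apply_eval hr (convex_ball z ε).isPreconnected (fun _ h => hball h)
    (Metric.mem_ball_self hε) hsz hy⟩

theorem IsBranch.differentiableAt (hs : IsBranch F T s) (hT : IsOpen T)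
    (hr : T ⊆ regularValues F) {w : ℂ} (hw : w ∈ T) : DifferentiableAt ℂ s w := by
  have hne : F.derivative.eval (s w) ≠ 0 := fun h => hr hw ⟨s w, h, hs.eval_apply w hw⟩
  refine (HasDerivAt.of_local_left_inverse (hs.continuousOn.continuousAt (hT.mem_nhds hw))
    (F.hasDerivAt (s w)) hne ?_).differentiableAt
  filter_upwards [hT.mem_nhds hw] with y hy using hs.eval_apply y hy

theorem exists_isBranch [SimplyConnectedSpace T] (hT : IsOpen T) (hr : T ⊆ regularValues F)
    {z : ℂ} (hz : F.eval z ∈ T) : ∃ s, IsBranch F T s ∧ s (F.eval z) = z := by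
  have : LocallyPathConnectedSpace T := hT.locallyPathConnectedSpace
  obtain ⟨φ, ⟨hφz, hφ⟩, -⟩ := F.isCoveringMapOn_eval.existsUnique_continuousMap_lifts
    (⟨Subtype.val, continuous_subtype_val⟩ : C(T, ℂ)) (a₀ := ⟨F.eval z, hz⟩) (e₀ := z) rfl
    (fun a => hr a.2)
  have hval : ∀ w (hw : w ∈ T), Function.extend Subtype.val φ 0 w = φ ⟨w, hw⟩ :=
    fun w hw => Subtype.val_injective.extend_apply φ 0 ⟨w, hw⟩
  refine ⟨Function.extend Subtype.val φ 0, ⟨?_, fun w hw => ?_⟩, ?_⟩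
  · rw [continuousOn_iff_continuous_domRestrict]
    exact φ.continuous.congr fun w => (hval w w.2).symm
  · rw [hval w hw]
    exact congrFun hφ ⟨w, hw⟩
  · rw [hval _ hz, hφz]

end Branches

/-! ### Slit planes -/

section Slits

/-- The plane slit along the real rays from `0` to `-∞` and from `1` to `∞`. -/
def doubleSlit : Set ℂ := {w | w.im ≠ 0 ∨ (0 < w.re ∧ w.re < 1)}

/-- The plane slit along the nonnegative reals. -/
def posSlit : Set ℂ := {w | w.im ≠ 0 ∨ w.re < 0}

/-- The open upper half plane, as a subset of `ℂ`. -/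
def upperHalf : Set ℂ := {w | 0 < w.im}

/-- The open lower half plane, as a subset of `ℂ`. -/
def lowerHalf : Set ℂ := {w | w.im < 0}

theorem isOpen_doubleSlit : IsOpen doubleSlit :=
  (isOpen_ne_fun Complex.continuous_im continuous_const).union
    ((isOpen_lt continuous_const Complex.continuous_re).inter
      (isOpen_lt Complex.continuous_re continuous_const))

theorem isOpen_posSlit : IsOpen posSlit :=
  (isOpen_ne_fun Complex.continuous_im continuous_const).union
    (isOpen_lt Complex.continuous_re continuous_const)

theorem doubleSlit_subset_regularValues {F : ℂ[X]} (hF : criticalValues F ⊆ {0, 1}) :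
    doubleSlit ⊆ regularValues F := by
  intro w hw hcrit
  rcases hF hcrit with rfl | rfl <;> simp [doubleSlit] at hw

theorem posSlit_subset_regularValues {F : ℂ[X]} (hF : criticalValues F ⊆ {0, 1}) :
    posSlit ⊆ regularValues F := by
  intro w hw hcrit
  rcases hF hcrit with rfl | rfl <;> norm_num [posSlit] at hw

theorem half_mem_Ioo : (1 / 2 : ℝ) ∈ Set.Ioo (0 : ℝ) 1 := by norm_num

theorem ofReal_mem_doubleSlit {x : ℝ} (hx : x ∈ Set.Ioo (0 : ℝ) 1) : (x : ℂ) ∈ doubleSlit :=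
  Or.inr (by simpa using hx)

theorem starConvex_doubleSlit : StarConvex ℝ ((1 / 2 : ℝ) : ℂ) doubleSlit := by
  rw [starConvex_iff_forall_pos (ofReal_mem_doubleSlit half_mem_Ioo)]
  rintro w (hw | hw) a b ha hb hab
  · left
    simpa using ⟨hb.ne', hw⟩
  · right
    simp only [Complex.add_re, Complex.real_smul, Complex.re_ofReal_mul, Complex.ofReal_re]
    constructor <;> nlinarith

theorem starConvex_posSlit : StarConvex ℝ ((-1 : ℝ) : ℂ) posSlit := by
  rw [starConvex_iff_forall_pos (by right; norm_num)]
  rintro w (hw | hw) a b ha hb _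
  · left
    simpa using ⟨hb.ne', hw⟩
  · right
    simp only [Complex.add_re, Complex.real_smul, Complex.re_ofReal_mul, Complex.ofReal_re]
    nlinarith

instance : ContractibleSpace doubleSlit :=
  starConvex_doubleSlit.contractibleSpace ⟨_, ofReal_mem_doubleSlit half_mem_Ioo⟩

instance : ContractibleSpace posSlit :=
  starConvex_posSlit.contractibleSpace ⟨((-1 : ℝ) : ℂ), Or.inr (by norm_num)⟩

theorem isPreconnected_doubleSlit : IsPreconnected doubleSlit :=
  isPreconnected_iff_preconnectedSpace.2 inferInstance

theorem isPreconnected_posSlit : IsPreconnected posSlit :=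
  isPreconnected_iff_preconnectedSpace.2 inferInstance

theorem isPreconnected_upperHalf : IsPreconnected upperHalf :=
  (convex_halfSpace_im_gt 0).isPreconnected

theorem isPreconnected_lowerHalf : IsPreconnected lowerHalf :=
  (convex_halfSpace_im_lt 0).isPreconnected

theorem I_mem_upperHalf : Complex.I ∈ upperHalf := by simp [upperHalf]

theorem neg_I_mem_lowerHalf : -Complex.I ∈ lowerHalf := by simp [lowerHalf]

theorem upperHalf_subset_doubleSlit : upperHalf ⊆ doubleSlit := fun _ hw => Or.inl (ne_of_gt hw)

theorem lowerHalf_subset_doubleSlit : lowerHalf ⊆ doubleSlit := fun _ hw => Or.inl (ne_of_lt hw)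

theorem upperHalf_subset_posSlit : upperHalf ⊆ posSlit := fun _ hw => Or.inl (ne_of_gt hw)

theorem lowerHalf_subset_posSlit : lowerHalf ⊆ posSlit := fun _ hw => Or.inl (ne_of_lt hw)

theorem one_sub_mem_doubleSlit {w : ℂ} (hw : w ∈ doubleSlit) : 1 - w ∈ doubleSlit := by
  rcases hw with h | h
  · left
    simpa using h
  · right
    simpa [and_comm] using h

theorem mem_slits_of_notMem_pair {w : ℂ} (hw : w ∉ ({0, 1} : Set ℂ)) :
    w ∈ doubleSlit ∨ w ∈ posSlit ∨ 1 - w ∈ posSlit := by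
  by_cases him : w.im = 0
  · rcases lt_trichotomy w.re 0 with h | h | h
    · exact Or.inr (Or.inl (Or.inr h))
    · exact absurd (Or.inl (Complex.ext h him)) hw
    · rcases lt_trichotomy w.re 1 with h' | h' | h'
      · exact Or.inl (Or.inr ⟨h, h'⟩)
      · exact absurd (Or.inr (Complex.ext h' him)) hw
      · exact Or.inr (Or.inr (Or.inr (by simpa using h')))
  · exact Or.inl (Or.inl him)

end Slits

/-! ### Edges and sheets -/

section Sheets

variable {F : ℂ[X]} {e e' : Set ℂ} {s s' : ℂ → ℂ}

theorem edge_subset (he : e ∈ (dessin F).edges) : e ⊆ openSegmentPreimage F := by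
  obtain ⟨z, -, rfl⟩ := he
  exact connectedComponentIn_subset _ _

theorem isPreconnected_edge (he : e ∈ (dessin F).edges) : IsPreconnected e := by
  obtain ⟨z, -, rfl⟩ := he
  exact isPreconnected_connectedComponentIn

theorem nonempty_edge (he : e ∈ (dessin F).edges) : e.Nonempty := by
  obtain ⟨z, hz, rfl⟩ := he
  exact ⟨z, mem_connectedComponentIn hz⟩

theorem edge_eq_of_mem (he : e ∈ (dessin F).edges) (he' : e' ∈ (dessin F).edges) {z : ℂ}
    (hz : z ∈ e) (hz' : z ∈ e') : e = e' := by
  obtain ⟨y, -, rfl⟩ := he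
  obtain ⟨y', -, rfl⟩ := he'
  exact (connectedComponentIn_eq hz).trans (connectedComponentIn_eq hz').symm

theorem exists_edge_mem {z : ℂ} (hz : z ∈ openSegmentPreimage F) :
    ∃ e ∈ (dessin F).edges, z ∈ e :=
  ⟨_, ⟨z, hz, rfl⟩, mem_connectedComponentIn hz⟩

theorem eval_mem_doubleSlit {z : ℂ} (hz : z ∈ openSegmentPreimage F) :
    F.eval z ∈ doubleSlit := by
  obtain ⟨t, ht, h⟩ := hz
  rw [h]
  exact ofReal_mem_doubleSlit ht

/-- The sheet of `F` at the edge `e`: the branch of the inverse of `F` over the doubly slit plane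
that carries the open segment from `0` to `1` to `e`. -/
structure IsSheet (F : ℂ[X]) (e : Set ℂ) (s : ℂ → ℂ) : Prop extends IsBranch F doubleSlit s where
  mem_edges : e ∈ (dessin F).edges
  mem_edge : ∀ x ∈ Set.Ioo (0 : ℝ) 1, s x ∈ e

theorem IsBranch.isSheet_of_mem (hs : IsBranch F doubleSlit s) (he : e ∈ (dessin F).edges) {x : ℝ}
    (hx : x ∈ Set.Ioo (0 : ℝ) 1) (hxe : s x ∈ e) : IsSheet F e s := by
  refine ⟨hs, he, fun y hy => ?_⟩
  obtain ⟨z, -, rfl⟩ := he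
  have hpre : IsPreconnected ((fun x : ℝ => s x) '' Set.Ioo 0 1) :=
    isPreconnected_Ioo.image _ (hs.continuousOn.comp Complex.continuous_ofReal.continuousOn
      fun _ => ofReal_mem_doubleSlit)
  rw [connectedComponentIn_eq hxe]
  refine hpre.subset_connectedComponentIn ⟨x, hx, rfl⟩ ?_ ⟨y, hy, rfl⟩
  rintro _ ⟨t, ht, rfl⟩
  exact ⟨t, ht, hs.eval_apply _ (ofReal_mem_doubleSlit ht)⟩

theorem IsBranch.exists_isSheet (hs : IsBranch F doubleSlit s) : ∃ e, IsSheet F e s := by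
  obtain ⟨e, he, hse⟩ := exists_edge_mem (F := F) (z := s ((1 / 2 : ℝ) : ℂ))
    ⟨_, half_mem_Ioo, hs.eval_apply _ (ofReal_mem_doubleSlit half_mem_Ioo)⟩
  exact ⟨e, hs.isSheet_of_mem he half_mem_Ioo hse⟩

theorem exists_isSheet_apply_eval (hF : criticalValues F ⊆ {0, 1}) {z : ℂ}
    (hz : F.eval z ∈ doubleSlit) : ∃ e s, IsSheet F e s ∧ s (F.eval z) = z := by
  obtain ⟨s, hs, hsz⟩ :=
    exists_isBranch isOpen_doubleSlit (doubleSlit_subset_regularValues hF) hz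
  obtain ⟨e, he⟩ := hs.exists_isSheet
  exact ⟨e, s, he, hsz⟩

theorem exists_isSheet_of_mem_edges (hF : criticalValues F ⊆ {0, 1}) (he : e ∈ (dessin F).edges) :
    ∃ s, IsSheet F e s := by
  obtain ⟨z, hz⟩ := nonempty_edge he
  have hzseg := edge_subset he hz
  obtain ⟨s, hs, hsz⟩ := exists_isBranch isOpen_doubleSlit (doubleSlit_subset_regularValues hF)
    (eval_mem_doubleSlit hzseg)
  obtain ⟨t, ht, hzt⟩ := hzseg
  refine ⟨s, hs.isSheet_of_mem he ht ?_⟩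
  rwa [← hzt, hsz]

theorem IsSheet.apply_eval (hF : criticalValues F ⊆ {0, 1}) (hs : IsSheet F e s) {z : ℂ}
    (hz : z ∈ e) : s (F.eval z) = z := by
  refine hs.toIsBranch.apply_eval (doubleSlit_subset_regularValues hF)
    (isPreconnected_edge hs.mem_edges)
    (fun y hy => eval_mem_doubleSlit (edge_subset hs.mem_edges hy))
    (hs.mem_edge _ half_mem_Ioo) ?_ hz
  rw [hs.eval_apply _ (ofReal_mem_doubleSlit half_mem_Ioo)]

theorem IsSheet.eqOn (hF : criticalValues F ⊆ {0, 1}) (hs : IsSheet F e s) (hs' : IsSheet F e s') :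
    Set.EqOn s s' doubleSlit := by
  have hhalf := ofReal_mem_doubleSlit half_mem_Ioo
  refine hs.toIsBranch.eqOn hs'.toIsBranch isPreconnected_doubleSlit
    (doubleSlit_subset_regularValues hF) hhalf ?_
  have h := hs.apply_eval hF (hs'.mem_edge _ half_mem_Ioo)
  rwa [hs'.eval_apply _ hhalf] at h

theorem IsSheet.edge_eq (hF : criticalValues F ⊆ {0, 1}) (hs : IsSheet F e s)
    (hs' : IsSheet F e' s') {w : ℂ} (hw : w ∈ doubleSlit) (h : s w = s' w) : e = e' := by
  have heq : Set.EqOn s s' doubleSlit := hs.toIsBranch.eqOn hs'.toIsBranch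
    isPreconnected_doubleSlit (doubleSlit_subset_regularValues hF) hw h
  refine edge_eq_of_mem hs.mem_edges hs'.mem_edges (hs.mem_edge _ half_mem_Ioo) ?_
  rw [heq (ofReal_mem_doubleSlit half_mem_Ioo)]
  exact hs'.mem_edge _ half_mem_Ioo

theorem IsBranch.exists_isSheet_eqOn (hF : criticalValues F ⊆ {0, 1}) {H : Set ℂ}
    (hs : IsBranch F H s) (hH : IsPreconnected H) (hHne : H.Nonempty) (hHs : H ⊆ doubleSlit) :
    ∃ e s', IsSheet F e s' ∧ Set.EqOn s s' H := by
  obtain ⟨w, hw⟩ := hHne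
  have hsw := hs.eval_apply w hw
  obtain ⟨e, s', hs', h⟩ := exists_isSheet_apply_eval hF (z := s w) (by rw [hsw]; exact hHs hw)
  rw [hsw] at h
  exact ⟨e, s', hs', hs.eqOn (hs'.toIsBranch.mono hHs) hH
    (hHs.trans (doubleSlit_subset_regularValues hF)) hw h.symm⟩

end Sheets

/-! ### Monodromy around `0` -/

section Monodromy

variable {F : ℂ[X]} {e e' : Set ℂ} {s : ℂ → ℂ}

/-- The branch `s` over `posSlit` crosses the negative reals from the sheet of `e`, which it
continues in the upper half plane, to the sheet of `e'` in the lower half plane. -/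
structure Crosses (F : ℂ[X]) (s : ℂ → ℂ) (e e' : Set ℂ) : Prop extends IsBranch F posSlit s where
  exists_upper : ∃ s₁, IsSheet F e s₁ ∧ Set.EqOn s s₁ upperHalf
  exists_lower : ∃ s₂, IsSheet F e' s₂ ∧ Set.EqOn s s₂ lowerHalf

/-- Lifting a small counterclockwise loop around `0` leads from the edge `e` to the edge `e'`. -/
def MonodromyNext (F : ℂ[X]) (e e' : Set ℂ) : Prop := ∃ s, Crosses F s e e'

theorem IsBranch.exists_crosses (hF : criticalValues F ⊆ {0, 1}) (hs : IsBranch F posSlit s) :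
    ∃ e e', Crosses F s e e' := by
  obtain ⟨e, s₁, h₁, k₁⟩ := (hs.mono upperHalf_subset_posSlit).exists_isSheet_eqOn hF
    isPreconnected_upperHalf ⟨_, I_mem_upperHalf⟩ upperHalf_subset_doubleSlit
  obtain ⟨e', s₂, h₂, k₂⟩ := (hs.mono lowerHalf_subset_posSlit).exists_isSheet_eqOn hF
    isPreconnected_lowerHalf ⟨_, neg_I_mem_lowerHalf⟩ lowerHalf_subset_doubleSlit
  exact ⟨e, e', hs, ⟨s₁, h₁, k₁⟩, s₂, h₂, k₂⟩

theorem Crosses.eqOn_upperHalf (hF : criticalValues F ⊆ {0, 1}) (h : Crosses F s e e')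
    {s₁ : ℂ → ℂ} (h₁ : IsSheet F e s₁) : Set.EqOn s s₁ upperHalf := by
  obtain ⟨t, ht, hst⟩ := h.exists_upper
  exact hst.trans ((ht.eqOn hF h₁).mono upperHalf_subset_doubleSlit)

theorem IsBranch.crosses_of_apply_eq (hF : criticalValues F ⊆ {0, 1}) (hs : IsBranch F posSlit s)
    {s₁ s₂ : ℂ → ℂ} (h₁ : IsSheet F e s₁) (h₂ : IsSheet F e' s₂) {a b : ℂ} (ha : a ∈ upperHalf)
    (hsa : s a = s₁ a) (hb : b ∈ lowerHalf) (hsb : s b = s₂ b) : Crosses F s e e' where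
  toIsBranch := hs
  exists_upper := ⟨s₁, h₁, (hs.mono upperHalf_subset_posSlit).eqOn
    (h₁.toIsBranch.mono upperHalf_subset_doubleSlit) isPreconnected_upperHalf
    (upperHalf_subset_posSlit.trans (posSlit_subset_regularValues hF)) ha hsa⟩
  exists_lower := ⟨s₂, h₂, (hs.mono lowerHalf_subset_posSlit).eqOn
    (h₂.toIsBranch.mono lowerHalf_subset_doubleSlit) isPreconnected_lowerHalf
    (lowerHalf_subset_posSlit.trans (posSlit_subset_regularValues hF)) hb hsb⟩

theorem MonodromyNext.left_mem_edges (h : MonodromyNext F e e') : e ∈ (dessin F).edges := by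
  obtain ⟨s, -, ⟨s₁, h₁, -⟩, -⟩ := h
  exact h₁.mem_edges

theorem MonodromyNext.right_mem_edges (h : MonodromyNext F e e') : e' ∈ (dessin F).edges := by
  obtain ⟨s, -, -, s₂, h₂, -⟩ := h
  exact h₂.mem_edges

theorem MonodromyNext.right_unique (hF : criticalValues F ⊆ {0, 1}) {e'' : Set ℂ}
    (h : MonodromyNext F e e') (h' : MonodromyNext F e e'') : e' = e'' := by
  obtain ⟨s, hs⟩ := h
  obtain ⟨t, ht⟩ := h'
  obtain ⟨s₁, h₁, hss₁⟩ := hs.exists_upper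
  have hst : Set.EqOn s t posSlit := hs.toIsBranch.eqOn ht.toIsBranch isPreconnected_posSlit
    (posSlit_subset_regularValues hF) (upperHalf_subset_posSlit I_mem_upperHalf)
    (by rw [hss₁ I_mem_upperHalf, ht.eqOn_upperHalf hF h₁ I_mem_upperHalf])
  obtain ⟨s₂, h₂, hss₂⟩ := hs.exists_lower
  obtain ⟨t₂, h₂', htt₂⟩ := ht.exists_lower
  refine h₂.edge_eq hF h₂' (lowerHalf_subset_doubleSlit neg_I_mem_lowerHalf) ?_
  rw [← hss₂ neg_I_mem_lowerHalf, ← htt₂ neg_I_mem_lowerHalf]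
  exact hst (lowerHalf_subset_posSlit neg_I_mem_lowerHalf)

end Monodromy

/-! ### The counterclockwise order around a preimage of `0` -/

section LogDeriv

variable {𝕜 : Type*} [NontriviallyNormedField 𝕜]

theorem sub_mul_eval_derivative_div_eval (q : 𝕜[X]) (n : ℕ) {v z : 𝕜} (hz : z ≠ v)
    (hq : q.eval z ≠ 0) :
    (z - v) * ((X - C v) ^ n * q).derivative.eval z / ((X - C v) ^ n * q).eval z
      = n + (z - v) * q.derivative.eval z / q.eval z := by
  have : z - v ≠ 0 := sub_ne_zero.2 hz
  rcases n with _ | n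
  · simp
  · simp only [derivative_mul, derivative_pow, derivative_sub, derivative_X, derivative_C, eval_add,
      eval_mul, eval_pow, eval_sub, eval_X, eval_C, sub_zero, mul_one,
      Nat.add_sub_cancel]
    field_simp
    ring

theorem tendsto_sub_mul_eval_derivative_div_eval {p : 𝕜[X]} (hp : p ≠ 0) (v : 𝕜) :
    Tendsto (fun z => (z - v) * p.derivative.eval z / p.eval z) (𝓝[≠] v)
      (𝓝 (p.rootMultiplicity v)) := by
  obtain ⟨q, hpq, hq⟩ := exists_eq_pow_rootMultiplicity_mul_and_not_dvd p hp v
  set n := p.rootMultiplicity v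
  have hqv : q.eval v ≠ 0 := fun h => hq (dvd_iff_isRoot.2 h)
  have hlim : ContinuousAt (fun z => (n : 𝕜) + (z - v) * q.derivative.eval z / q.eval z) v := by
    have := q.derivative.continuous.continuousAt (x := v)
    have := q.continuous.continuousAt (x := v)
    fun_prop (disch := assumption)
  have hn : (n : 𝕜) + (v - v) * q.derivative.eval v / q.eval v = n := by simp
  rw [ContinuousAt, hn] at hlim
  refine (hlim.mono_left nhdsWithin_le_nhds).congr' ?_
  filter_upwards [self_mem_nhdsWithin,
    nhdsWithin_le_nhds (q.continuous.continuousAt.eventually_ne hqv)] with z hz hqz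
  rw [hpq, sub_mul_eval_derivative_div_eval q n hz hqz]

end LogDeriv

section SmallCircles

variable {F : ℂ[X]} {v : ℂ} {r θ : ℝ}

/-- The circle of radius `r` around the zero `v` of `F` is small: it avoids the zeros of `F`, its
image lies in the open unit disc, and the argument of `F` increases along it. -/
structure IsSmallRadius (F : ℂ[X]) (v : ℂ) (r : ℝ) : Prop where
  eval_ne_zero : ∀ t, F.eval (circleMap v r t) ≠ 0
  norm_eval_lt_one : ∀ t, ‖F.eval (circleMap v r t)‖ < 1
  re_logDeriv_pos : ∀ t, 0 < ((circleMap v r t - v) * F.derivative.eval (circleMap v r t)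
    / F.eval (circleMap v r t)).re

theorem eventually_nhdsGT_forall_circleMap {P : ℂ → Prop} (h : ∀ᶠ z in 𝓝[≠] v, P z) :
    ∀ᶠ r in 𝓝[>] (0 : ℝ), ∀ t, P (circleMap v r t) := by
  obtain ⟨ε, hε, hP⟩ := Metric.eventually_nhds_iff.1 (eventually_nhdsWithin_iff.1 h)
  filter_upwards [Ioo_mem_nhdsGT hε] with r hr t
  refine hP ?_ (circleMap_ne_center hr.1.ne')
  rw [dist_eq_norm, circleMap_sub_center, norm_circleMap_zero, abs_of_pos hr.1]
  exact hr.2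

theorem eventually_isSmallRadius (hF0 : F ≠ 0) (hv : F.eval v = 0) :
    ∀ᶠ r in 𝓝[>] (0 : ℝ), IsSmallRadius F v r := by
  have hmult : 0 < F.rootMultiplicity v := (rootMultiplicity_pos hF0).2 hv
  have hre : ∀ᶠ z in 𝓝[≠] v, 0 < ((z - v) * F.derivative.eval z / F.eval z).re := by
    refine ((Complex.continuous_re.tendsto _).comp
      (tendsto_sub_mul_eval_derivative_div_eval hF0 v)).eventually_const_lt ?_
    simpa using hmult
  have hnorm : ∀ᶠ z in 𝓝[≠] v, ‖F.eval z‖ < 1 :=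
    nhdsWithin_le_nhds (F.continuous.norm.continuousAt.eventually_lt continuousAt_const
      (by simp [hv]))
  filter_upwards [eventually_nhdsGT_forall_circleMap hre,
    eventually_nhdsGT_forall_circleMap hnorm] with r hre hnorm
  exact ⟨fun t h => by simpa [h] using hre t, hnorm, hre⟩

theorem IsSmallRadius.eventually_sign_im (h : IsSmallRadius F v r) {x : ℝ} (hx : 0 < x)
    (hθ : F.eval (circleMap v r θ) = x) :
    ∀ᶠ t in 𝓝 θ, SignType.sign (F.eval (circleMap v r t)).im = SignType.sign (t - θ) := by
  have hderiv : HasDerivAt (fun t => (F.eval (circleMap v r t)).im)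
      (F.derivative.eval (circleMap v r θ) * (circleMap 0 r θ * Complex.I)).im θ :=
    Complex.imCLM.hasFDerivAt.comp_hasDerivAt θ
      ((F.hasDerivAt (circleMap v r θ)).comp θ (hasDerivAt_circleMap v r θ))
  have hpos : 0 < (F.derivative.eval (circleMap v r θ) * (circleMap 0 r θ * Complex.I)).im := by
    have hre := h.re_logDeriv_pos θ
    rw [hθ, circleMap_sub_center, Complex.div_ofReal_re, div_pos_iff_of_pos_right hx] at hre
    rwa [← mul_assoc, Complex.mul_I_im, mul_comm]
  rw [← hderiv.deriv] at hpos
  exact eventually_nhdsWithin_sign_eq_of_deriv_pos hpos (by rw [hθ, Complex.ofReal_im])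

theorem IsSmallRadius.eventually_mem_upperHalf (h : IsSmallRadius F v r) {x : ℝ} (hx : 0 < x)
    (hθ : F.eval (circleMap v r θ) = x) :
    ∀ᶠ t in 𝓝[>] θ, F.eval (circleMap v r t) ∈ upperHalf := by
  filter_upwards [nhdsWithin_le_nhds (h.eventually_sign_im hx hθ), self_mem_nhdsWithin]
    with t ht hlt
  rw [sign_pos (sub_pos.2 hlt)] at ht
  exact sign_eq_one_iff.1 ht

theorem IsSmallRadius.eventually_mem_lowerHalf (h : IsSmallRadius F v r) {x : ℝ} (hx : 0 < x)
    (hθ : F.eval (circleMap v r θ) = x) :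
    ∀ᶠ t in 𝓝[<] θ, F.eval (circleMap v r t) ∈ lowerHalf := by
  filter_upwards [nhdsWithin_le_nhds (h.eventually_sign_im hx hθ), self_mem_nhdsWithin]
    with t ht hlt
  rw [sign_neg (sub_neg.2 hlt)] at ht
  exact sign_eq_neg_one_iff.1 ht

theorem mem_support_dessin {z : ℂ} :
    z ∈ (dessin F).support ↔ ∃ t ∈ Set.Icc (0 : ℝ) 1, F.eval z = (t : ℂ) := by
  constructor
  · rintro ((h | h) | ⟨e, he, hz⟩)
    · exact ⟨0, by simp, by simpa [dessin] using h⟩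
    · exact ⟨1, by simp, by simpa [dessin] using h⟩
    · obtain ⟨t, ht, h⟩ := edge_subset he hz
      exact ⟨t, Set.Ioo_subset_Icc_self ht, h⟩
  · rintro ⟨t, ⟨h0, h1⟩, h⟩
    rcases h0.eq_or_lt with rfl | h0
    · exact Or.inl (Or.inl (by simpa [dessin] using h))
    rcases h1.eq_or_lt with rfl | h1
    · exact Or.inl (Or.inr (by simpa [dessin] using h))
    obtain ⟨e, he, hz⟩ := exists_edge_mem (F := F) ⟨t, ⟨h0, h1⟩, h⟩
    exact Or.inr ⟨e, he, hz⟩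

theorem isClosed_support_dessin (F : ℂ[X]) : IsClosed (dessin F).support := by
  have hpre : (dessin F).support = F.eval ⁻¹' ((fun x : ℝ => (x : ℂ)) '' Set.Icc 0 1) := by
    ext z
    simp only [mem_support_dessin, Set.mem_preimage, Set.mem_image, eq_comm]
  rw [hpre]
  exact (isCompact_Icc.image Complex.continuous_ofReal).isClosed.preimage F.continuous

theorem notMem_support_of_eval_mem_upperHalf {z : ℂ} (hz : F.eval z ∈ upperHalf) :
    z ∉ (dessin F).support := by
  intro h
  obtain ⟨t, -, ht⟩ := mem_support_dessin.1 h
  simp [upperHalf, ht] at hz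

theorem IsSmallRadius.mem_posSlit (h : IsSmallRadius F v r) {t : ℝ}
    (ht : circleMap v r t ∉ (dessin F).support) : F.eval (circleMap v r t) ∈ posSlit := by
  by_contra hcon
  simp only [posSlit, Set.mem_ofPred_eq, not_or, not_not, not_lt] at hcon
  refine ht (mem_support_dessin.2 ⟨(F.eval (circleMap v r t)).re, ⟨hcon.2, ?_⟩, ?_⟩)
  · exact (Complex.re_le_norm _).trans (h.norm_eval_lt_one t).le
  · exact Complex.ext (by simp) (by simp [hcon.1])

theorem IsSmallRadius.exists_edge_mem (h : IsSmallRadius F v r)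
    (hθ : circleMap v r θ ∈ (dessin F).support) : ∃ e ∈ (dessin F).edges, circleMap v r θ ∈ e := by
  obtain ⟨y, hy, hFy⟩ := mem_support_dessin.1 hθ
  refine BelyiDessin.exists_edge_mem ⟨y, ⟨hy.1.lt_of_ne ?_, hy.2.lt_of_ne ?_⟩, hFy⟩
  · rintro rfl
    exact h.eval_ne_zero θ (by simpa using hFy)
  · rintro rfl
    simpa [hFy] using h.norm_eval_lt_one θ

end SmallCircles

section CcwOrder

variable {F : ℂ[X]} {v : ℂ} {r : ℝ} {e e' : Set ℂ} {s : ℂ → ℂ}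

theorem IsSheet.eventually_circleMap (hF : criticalValues F ⊆ {0, 1}) (hs : IsSheet F e s) {θ : ℝ}
    (hθ : circleMap v r θ ∈ e) :
    ∀ᶠ t in 𝓝 θ, s (F.eval (circleMap v r t)) = circleMap v r t := by
  have h := hs.toIsBranch.eventually_apply_eval isOpen_doubleSlit
    (doubleSlit_subset_regularValues hF) (eval_mem_doubleSlit (edge_subset hs.mem_edges hθ))
    (hs.apply_eval hF hθ)
  filter_upwards [(continuous_circleMap v r).continuousAt.eventually h] with t ht using ht.2

/-- The arc is mapped into `posSlit`, so a branch over `posSlit` follows it; near its end points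
that branch agrees with the sheets of `e` and `e'`. -/
theorem IsSmallRadius.monodromyNext (hF : criticalValues F ⊆ {0, 1}) (h : IsSmallRadius F v r)
    (he : e ∈ (dessin F).edges) (he' : e' ∈ (dessin F).edges) {θ θ' : ℝ} (hlt : θ < θ')
    (hθ : circleMap v r θ ∈ e) (hθ' : circleMap v r θ' ∈ e')
    (harc : ∀ t ∈ Set.Ioo θ θ', circleMap v r t ∉ (dessin F).support) : MonodromyNext F e e' := by
  have hposSlit := posSlit_subset_regularValues hF
  obtain ⟨s₁, h₁⟩ := exists_isSheet_of_mem_edges hF he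
  obtain ⟨s₂, h₂⟩ := exists_isSheet_of_mem_edges hF he'
  obtain ⟨x, hx, hFx⟩ := edge_subset he hθ
  obtain ⟨x', hx', hFx'⟩ := edge_subset he' hθ'
  have hslit : ∀ t ∈ Set.Ioo θ θ', F.eval (circleMap v r t) ∈ posSlit :=
    fun t ht => h.mem_posSlit (harc t ht)
  have hright : ∀ᶠ t in 𝓝[>] θ, t ∈ Set.Ioo θ θ' := Ioo_mem_nhdsGT hlt
  have hleft : ∀ᶠ t in 𝓝[<] θ', t ∈ Set.Ioo θ θ' := Ioo_mem_nhdsLT hlt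
  obtain ⟨a, haθ, ha, hs₁a⟩ : ∃ a ∈ Set.Ioo θ θ', F.eval (circleMap v r a) ∈ upperHalf ∧
      s₁ (F.eval (circleMap v r a)) = circleMap v r a :=
    (hright.and ((h.eventually_mem_upperHalf hx.1 hFx).and
      (eventually_nhdsWithin_of_eventually_nhds (h₁.eventually_circleMap hF hθ)))).exists
  obtain ⟨b, hbθ, hb, hs₂b⟩ : ∃ b ∈ Set.Ioo θ θ', F.eval (circleMap v r b) ∈ lowerHalf ∧
      s₂ (F.eval (circleMap v r b)) = circleMap v r b :=
    (hleft.and ((h.eventually_mem_lowerHalf hx'.1 hFx').and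
      (eventually_nhdsWithin_of_eventually_nhds (h₂.eventually_circleMap hF hθ')))).exists
  obtain ⟨s, hs, hsa⟩ := exists_isBranch isOpen_posSlit hposSlit (hslit a haθ)
  have hsb : s (F.eval (circleMap v r b)) = circleMap v r b :=
    hs.apply_eval hposSlit (isPreconnected_Ioo.image _ (continuous_circleMap v r).continuousOn)
      (Set.forall_mem_image.2 hslit) (Set.mem_image_of_mem _ haθ) hsa (Set.mem_image_of_mem _ hbθ)
  exact ⟨s, hs.crosses_of_apply_eq hF h₁ h₂ ha (hsa.trans hs₁a.symm) hb (hsb.trans hs₂b.symm)⟩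

theorem monodromyNext_of_ccwNext (hF : criticalValues F ⊆ {0, 1}) (hF0 : F ≠ 0)
    (hv : F.eval v = 0) (he : e ∈ (dessin F).edges) (he' : e' ∈ (dessin F).edges)
    (h : (dessin F).CcwNext v e e') : MonodromyNext F e e' := by
  obtain ⟨r, hr, θ, θ', hlt, -, hθ, hθ', harc⟩ :=
    ((eventually_isSmallRadius hF0 hv).and h).exists
  exact hr.monodromyNext hF he he' hlt hθ hθ' harc

theorem exists_first_mem_of_eventually_notMem {α : Type*} [ConditionallyCompleteLinearOrder α]
    [TopologicalSpace α] [OrderTopology α] {A : Set α} (hA : IsClosed A) {a b : α} (hab : a < b)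
    (hb : b ∈ A) (ha : ∀ᶠ t in 𝓝[>] a, t ∉ A) :
    ∃ c ∈ A, a < c ∧ c ≤ b ∧ ∀ t ∈ Set.Ioo a c, t ∉ A := by
  obtain ⟨δ, hδ, hδA⟩ := (mem_nhdsGT_iff_exists_mem_Ioc_Ioo_subset hab).1 ha
  obtain ⟨c, ⟨hc, hcA⟩, hmin⟩ := (isCompact_Icc.inter_right hA).exists_isLeast
    (s := Set.Icc δ b ∩ A) ⟨b, ⟨hδ.2, le_rfl⟩, hb⟩
  refine ⟨c, hcA, hδ.1.trans_le hc.1, hc.2, fun t ht htA => ?_⟩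
  rcases lt_or_ge t δ with htδ | htδ
  · exact hδA ⟨ht.1, htδ⟩ htA
  · exact (hmin ⟨⟨htδ, ht.2.le.trans hc.2⟩, htA⟩).not_gt ht.2

theorem IsSmallRadius.exists_next (h : IsSmallRadius F v r) (he : e ∈ (dessin F).edges) {θ : ℝ}
    (hθ : circleMap v r θ ∈ e) :
    ∃ e' ∈ (dessin F).edges, ∃ θ', θ < θ' ∧ θ' ≤ θ + 2 * Real.pi ∧ circleMap v r θ' ∈ e' ∧
      ∀ t ∈ Set.Ioo θ θ', circleMap v r t ∉ (dessin F).support := by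
  obtain ⟨x, hx, hFx⟩ := edge_subset he hθ
  have hturn : circleMap v r (θ + 2 * Real.pi) ∈ (dessin F).support := by
    rw [periodic_circleMap v r θ]
    exact Or.inr ⟨e, he, hθ⟩
  obtain ⟨θ', hθ', hlt, hle, harc⟩ := exists_first_mem_of_eventually_notMem
    ((isClosed_support_dessin F).preimage (continuous_circleMap v r))
    (lt_add_of_pos_right θ Real.two_pi_pos) hturn
    ((h.eventually_mem_upperHalf hx.1 hFx).mono fun _ => notMem_support_of_eval_mem_upperHalf)
  obtain ⟨e', he', hmem⟩ := h.exists_edge_mem hθ'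
  exact ⟨e', he', θ', hlt, hle, hmem, harc⟩

theorem eventually_exists_circleMap_mem {K : Set ℂ} (hK : IsPreconnected K)
    (hne : K.Nonempty) (hv : v ∉ K) (hvK : v ∈ closure K) :
    ∀ᶠ r in 𝓝[>] (0 : ℝ), ∃ θ : ℝ, circleMap v r θ ∈ K := by
  obtain ⟨p, hp⟩ := hne
  have hpv : 0 < dist p v := dist_pos.2 fun h => hv (h ▸ hp)
  filter_upwards [Ioo_mem_nhdsGT hpv] with r hr
  obtain ⟨q, hq, hqr⟩ := Metric.mem_closure_iff.1 hvK r hr.1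
  obtain ⟨y, hy, hyr⟩ := hK.intermediate_value hq hp (f := fun y => dist y v) (by fun_prop)
    (show r ∈ Set.Icc _ _ from ⟨by rw [dist_comm]; exact hqr.le, hr.2.le⟩)
  have hsphere : y ∈ Metric.sphere v |r| := by rwa [abs_of_pos hr.1]
  rw [← range_circleMap] at hsphere
  obtain ⟨θ, rfl⟩ := hsphere
  exact ⟨θ, hy⟩

theorem notMem_edge_of_eval_eq_zero (he : e ∈ (dessin F).edges) (hv : F.eval v = 0) : v ∉ e := by
  intro hve
  obtain ⟨t, ht, h⟩ := edge_subset he hve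
  rw [hv] at h
  exact ht.1.ne (by exact_mod_cast h)

theorem ccwNext_of_monodromyNext (hF : criticalValues F ⊆ {0, 1}) (hF0 : F ≠ 0)
    (hv : F.eval v = 0) (hve : v ∈ closure e) (h : MonodromyNext F e e') :
    (dessin F).CcwNext v e e' := by
  have he := h.left_mem_edges
  filter_upwards [eventually_isSmallRadius hF0 hv,
    eventually_exists_circleMap_mem (isPreconnected_edge he) (nonempty_edge he)
      (notMem_edge_of_eval_eq_zero he hv) hve] with r hr ⟨θ, hθ⟩
  obtain ⟨e'', he'', θ', hlt, hle, hθ', harc⟩ := hr.exists_next he hθ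
  obtain rfl : e'' = e' := (hr.monodromyNext hF he he'' hlt hθ hθ' harc).right_unique hF h
  exact ⟨θ, θ', hlt, hle, hθ, hθ', harc⟩

theorem exists_zero_mem_closure (hF : criticalValues F ⊆ {0, 1}) (he : e ∈ (dessin F).edges) :
    ∃ v, F.eval v = 0 ∧ v ∈ closure e := by
  obtain ⟨s, hs⟩ := exists_isSheet_of_mem_edges hF he
  have hsub : (fun x : ℝ => (x : ℂ)) '' Set.Ioo 0 1 ⊆ F.eval '' closure e := by
    rintro _ ⟨x, hx, rfl⟩
    exact ⟨s x, subset_closure (hs.mem_edge x hx), hs.eval_apply _ (ofReal_mem_doubleSlit hx)⟩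
  have hzero : (0 : ℂ) ∈ closure ((fun x : ℝ => (x : ℂ)) '' Set.Ioo 0 1) := by
    refine image_closure_subset_closure_image Complex.continuous_ofReal ⟨0, ?_, by simp⟩
    rw [closure_Ioo zero_ne_one]
    simp
  obtain ⟨v, hve, hv⟩ := closure_minimal hsub (F.isClosedMap_eval _ isClosed_closure) hzero
  exact ⟨v, hv, hve⟩

theorem MonodromyNext.map_of_ccwNext {G : ℂ[X]} (hF : criticalValues F ⊆ {0, 1})
    (hG : criticalValues G ⊆ {0, 1}) (hF0 : F ≠ 0) (hG0 : G ≠ 0) {j : Set ℂ → Set ℂ}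
    (hj : Set.MapsTo j (dessin F).edges (dessin G).edges)
    (hccw : ∀ v, F.eval v = 0 → ∃ v', G.eval v' = 0 ∧ ∀ e ∈ (dessin F).edges,
      ∀ e' ∈ (dessin F).edges, (dessin F).CcwNext v e e' → (dessin G).CcwNext v' (j e) (j e'))
    (h : MonodromyNext F e e') : MonodromyNext G (j e) (j e') := by
  have he := h.left_mem_edges
  have he' := h.right_mem_edges
  obtain ⟨v, hv, hve⟩ := exists_zero_mem_closure hF he
  obtain ⟨v', hv', hvv'⟩ := hccw v hv
  exact monodromyNext_of_ccwNext hG hG0 hv' (hj he) (hj he')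
    (hvv' e he e' he' (ccwNext_of_monodromyNext hF hF0 hv hve h))

end CcwOrder

/-! ### Exchanging the colors -/

section OneSub

variable {F : ℂ[X]} {e e' : Set ℂ}

theorem criticalValues_one_sub_subset (hF : criticalValues F ⊆ {0, 1}) :
    criticalValues (1 - F) ⊆ {0, 1} := by
  rintro _ ⟨z, hz, rfl⟩
  have hz' : z ∈ criticalPoints F := by simpa [criticalPoints] using hz
  rcases hF ⟨z, hz', rfl⟩ with h | h
  · right
    simpa using h
  · left
    have h1 : F.eval z = 1 := h
    simp [h1]

theorem openSegmentPreimage_one_sub (F : ℂ[X]) :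
    openSegmentPreimage (1 - F) = openSegmentPreimage F := by
  have hsub : ∀ P : ℂ[X], openSegmentPreimage P ⊆ openSegmentPreimage (1 - P) := by
    rintro P z ⟨t, ht, h⟩
    exact ⟨1 - t, ⟨by linarith [ht.2], by linarith [ht.1]⟩, by simp [h]⟩
  refine Set.Subset.antisymm ?_ (hsub F)
  simpa using hsub (1 - F)

theorem edges_one_sub (F : ℂ[X]) : (dessin (1 - F)).edges = (dessin F).edges := by
  simp only [dessin, openSegmentPreimage_one_sub]

theorem mem_black_one_sub {z : ℂ} : z ∈ (dessin (1 - F)).black ↔ z ∈ (dessin F).white := by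
  change (1 - F).eval z = 0 ↔ F.eval z = 1
  rw [eval_sub, eval_one, sub_eq_zero, eq_comm]

theorem mem_white_one_sub {z : ℂ} : z ∈ (dessin (1 - F)).white ↔ z ∈ (dessin F).black := by
  simp [dessin]

theorem ccwNext_one_sub {v : ℂ} :
    (dessin (1 - F)).CcwNext v e e' ↔ (dessin F).CcwNext v e e' := by
  have hsupport : (dessin (1 - F)).support = (dessin F).support := by
    ext z
    simp only [PlaneDrawing.support, edges_one_sub, Set.mem_union, mem_black_one_sub,
      mem_white_one_sub, or_comm (a := z ∈ (dessin F).white)]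
  simp only [PlaneDrawing.CcwNext, hsupport]

theorem IsSheet.of_one_sub {s : ℂ → ℂ} (hs : IsSheet (1 - F) e s) :
    IsSheet F e (fun w => s (1 - w)) := by
  refine ⟨⟨?_, fun w hw => ?_⟩, by rw [← edges_one_sub]; exact hs.mem_edges, fun x hx => ?_⟩
  · exact hs.continuousOn.comp (continuous_const.sub continuous_id).continuousOn
      fun w hw => one_sub_mem_doubleSlit hw
  · have h := hs.eval_apply _ (one_sub_mem_doubleSlit hw)
    rw [eval_sub, eval_one] at h
    linear_combination -h
  · simpa using hs.mem_edge (1 - x) ⟨by linarith [hx.2], by linarith [hx.1]⟩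

end OneSub

/-! ### Entire lifts through polynomials -/

section Extension

/-- The restriction of `φ` to `V` agrees near `x` with a function that is differentiable in a whole
neighborhood of `x`. -/
def ExtendsAt (𝕜 : Type*) {M E : Type*} [NontriviallyNormedField 𝕜] [NormedAddCommGroup M]
    [NormedSpace 𝕜 M] [NormedAddCommGroup E] [NormedSpace 𝕜 E] (V : Set M) (φ : M → E) (x : M) :
    Prop :=
  ∃ ψ : M → E, (∀ᶠ y in 𝓝 x, DifferentiableAt 𝕜 ψ y) ∧ ∀ᶠ y in 𝓝 x, y ∈ V → φ y = ψ y

variable {𝕜 M E : Type*} [NontriviallyNormedField 𝕜] [NormedAddCommGroup M] [NormedSpace 𝕜 M]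
  [NormedAddCommGroup E] [NormedSpace 𝕜 E]

theorem ExtendsAt.mono {V W : Set M} {φ : M → E} {x : M} (h : ExtendsAt 𝕜 V φ x) (hWV : W ⊆ V) :
    ExtendsAt 𝕜 W φ x := by
  obtain ⟨ψ, hψ, heq⟩ := h
  exact ⟨ψ, hψ, heq.mono fun _ hy hyW => hy (hWV hyW)⟩

theorem eq_of_eventuallyEq_nhdsWithin {X Y : Type*} [TopologicalSpace X] [TopologicalSpace Y]
    [T2Space Y] {f g : X → Y} {V : Set X} {x : X} (hf : ContinuousAt f x) (hg : ContinuousAt g x)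
    (hx : x ∈ closure V) (h : f =ᶠ[𝓝[V] x] g) : f x = g x := by
  have : (𝓝[V] x).NeBot := mem_closure_iff_nhdsWithin_neBot.1 hx
  exact tendsto_nhds_unique_of_eventuallyEq (hf.tendsto.mono_left nhdsWithin_le_nhds)
    (hg.tendsto.mono_left nhdsWithin_le_nhds) h

theorem exists_differentiableOn_extension {U V : Set M} (hUV : U ⊆ closure V) (hU : IsOpen U)
    {φ : M → E} (h : ∀ x ∈ U, ExtendsAt 𝕜 V φ x) :
    ∃ Φ : M → E, DifferentiableOn 𝕜 Φ U ∧ Set.EqOn Φ φ (V ∩ U) := by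
  choose! ψ hψd hψ using h
  refine ⟨fun x => ψ x x, fun x hx => ?_, fun x hx => ((hψ x hx.2).self_of_nhds hx.1).symm⟩
  have heq : (fun y => ψ y y) =ᶠ[𝓝 x] ψ x := by
    filter_upwards [hU.mem_nhds hx, hψd x hx, (hψ x hx).eventually_nhds] with y hy hyd hyV
    refine eq_of_eventuallyEq_nhdsWithin (hψd y hy).self_of_nhds.continuousAt hyd.continuousAt
      (hUV hy) ?_
    filter_upwards [self_mem_nhdsWithin, nhdsWithin_le_nhds (hψ y hy), nhdsWithin_le_nhds hyV]
      with x' hx' hy' hx''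
    rw [← hy' hx', ← hx'' hx']
  exact ((hψd x hx).self_of_nhds.congr_of_eventuallyEq heq).differentiableWithinAt

end Extension

section RemovableSingularity

variable {E : Type*} [NormedAddCommGroup E] [NormedSpace ℂ E]

theorem extendsAt_of_isBoundedUnder [CompleteSpace E] {φ : ℂ → E} {z : ℂ}
    (hd : ∀ᶠ y in 𝓝[≠] z, DifferentiableAt ℂ φ y)
    (hb : IsBoundedUnder (· ≤ ·) (𝓝[≠] z) fun y => ‖φ y‖) : ExtendsAt ℂ {z}ᶜ φ z := by
  obtain ⟨R, hR⟩ := hb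
  have hs := eventually_nhdsWithin_iff.1 (hd.and (eventually_map.1 hR))
  have hdiff := Complex.differentiableOn_update_limUnder_of_bddAbove hs
    (fun y hy => (hy.1 hy.2).1.differentiableWithinAt)
    ⟨R, Set.forall_mem_image.2 fun y hy => (hy.1 hy.2).2⟩
  refine ⟨Function.update φ z (limUnder (𝓝[≠] z) φ), ?_,
    Eventually.of_forall fun y hy => (Function.update_of_ne hy _ _).symm⟩
  filter_upwards [eventually_mem_nhds_iff.2 hs] with y hy using hdiff.differentiableAt hy

theorem exists_differentiable_extension_of_finite [CompleteSpace E] {S : Set ℂ} (hS : S.Finite)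
    {φ : ℂ → E} (hφ : DifferentiableOn ℂ φ Sᶜ)
    (hb : ∀ z ∈ S, IsBoundedUnder (· ≤ ·) (𝓝[≠] z) fun y => ‖φ y‖) :
    ∃ Φ : ℂ → E, Differentiable ℂ Φ ∧ Set.EqOn Φ φ Sᶜ := by
  have hdiff : ∀ y ∈ Sᶜ, DifferentiableAt ℂ φ y :=
    fun y hy => hφ.differentiableAt (hS.isClosed.isOpen_compl.mem_nhds hy)
  have hext : ∀ z, ExtendsAt ℂ Sᶜ φ z := by
    intro z
    by_cases hz : z ∈ S
    · have hpunctured : ∀ᶠ y in 𝓝[≠] z, y ∉ S :=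
        nhdsNE_le_cofinite z hS.compl_mem_cofinite
      exact (extendsAt_of_isBoundedUnder (hpunctured.mono hdiff) (hb z hz)).mono
        (Set.compl_subset_compl.2 (Set.singleton_subset_iff.2 hz))
    · exact ⟨φ, (hS.isClosed.isOpen_compl.eventually_mem hz).mono hdiff,
        Eventually.of_forall fun _ _ => rfl⟩
  obtain ⟨Φ, hΦ, heq⟩ := exists_differentiableOn_extension (U := Set.univ)
    (fun z _ => hS.countable.dense_compl ℝ z) isOpen_univ (fun z _ => hext z)
  exact ⟨Φ, differentiableOn_univ.1 hΦ, by rwa [Set.inter_univ] at heq⟩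

theorem exists_eq_smul_add_of_isBigO_id {Φ : ℂ → E} [CompleteSpace E] (hΦ : Differentiable ℂ Φ)
    (hO : Φ =O[Bornology.cobounded ℂ] (fun z => z)) : ∃ a b : E, ∀ z, Φ z = z • a + b := by
  have hdslope : Differentiable ℂ (dslope Φ 0) := by
    rw [← differentiableOn_univ, Complex.differentiableOn_dslope univ_mem]
    exact hΦ.differentiableOn
  have hO' : dslope Φ 0 =O[Bornology.cobounded ℂ] (fun _ => (1 : ℂ)) := by
    have hsub : (fun z => Φ z - Φ 0) =O[Bornology.cobounded ℂ] (fun z => z) :=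
      hO.sub (Asymptotics.isLittleO_const_id_cobounded (Φ 0)).isBigO
    refine ((Asymptotics.isBigO_refl (fun z : ℂ => z⁻¹) _).smul hsub).congr' ?_ ?_
    all_goals filter_upwards [Bornology.eventually_ne_cobounded (0 : ℂ)] with z hz
    · rw [dslope_of_ne _ hz, slope_def_module, sub_zero]
    · rw [smul_eq_mul, inv_mul_cancel₀ hz]
  have hbdd : Bornology.IsBounded (Set.range (dslope Φ 0)) := by
    rw [hdslope.continuous.isBounded_range_iff_isBigO, ← Metric.cobounded_eq_cocompact]
    exact hO'.trans (Asymptotics.isBigO_const_const _ one_ne_zero _)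
  refine ⟨dslope Φ 0 0, Φ 0, fun z => ?_⟩
  have h := sub_smul_dslope Φ 0 z
  rwa [sub_zero, hdslope.apply_eq_apply_of_bounded hbdd z 0, eq_sub_iff_add_eq, eq_comm] at h

end RemovableSingularity

section EntireLift

variable {F G : ℂ[X]} {Φ : ℂ → ℂ}

theorem finite_setOf_eval_eq {R : Type*} [CommRing R] [IsDomain R] {p : R[X]}
    (hp : 0 < p.natDegree) (c : R) : {z | p.eval z = c}.Finite := by
  classical
  refine (p - C c).roots.toFinset.finite_toSet.subset fun z hz => ?_
  have hz' : p.eval z = c := hz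
  simp [sub_C_ne_zero hp c, hz']

theorem isBoundedUnder_norm_of_eval {α : Type*} {l : Filter α} {u : α → ℂ} (hG : 0 < G.natDegree)
    (h : IsBoundedUnder (· ≤ ·) l fun a => ‖G.eval (u a)‖) :
    IsBoundedUnder (· ≤ ·) l fun a => ‖u a‖ := by
  obtain ⟨R, hR⟩ := h
  have hcompact : IsCompact (G.eval ⁻¹' Metric.closedBall 0 R) :=
    (G.isProperMap_eval (natDegree_pos_iff_degree_pos.1 hG)).isCompact_preimage
      (isCompact_closedBall 0 R)
  obtain ⟨B, hB⟩ := hcompact.isBounded.exists_norm_le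
  refine ⟨B, eventually_map.2 ?_⟩
  filter_upwards [eventually_map.1 hR] with a ha using hB _ (by simpa using ha)

theorem exists_differentiable_lift (hGd : 0 < G.natDegree) {S : Set ℂ} (hS : S.Finite)
    (hΦ : DifferentiableOn ℂ Φ Sᶜ) (h : ∀ z ∉ S, G.eval (Φ z) = F.eval z) :
    ∃ Ψ : ℂ → ℂ, Differentiable ℂ Ψ ∧ ∀ z, G.eval (Ψ z) = F.eval z := by
  have hdense : Dense Sᶜ := hS.countable.dense_compl ℝ
  have hbdd : ∀ z, IsBoundedUnder (· ≤ ·) (𝓝[≠] z) fun y => ‖Φ y‖ := fun z => by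
    have hF : IsBoundedUnder (· ≤ ·) (𝓝[≠] z) fun y => ‖F.eval y‖ :=
      (F.continuous.norm.tendsto z).isBoundedUnder_le.mono nhdsWithin_le_nhds
    refine isBoundedUnder_norm_of_eval hGd (hF.mono_le ?_)
    filter_upwards [nhdsNE_le_cofinite z hS.compl_mem_cofinite] with y hy
    rw [h y hy]
  obtain ⟨Ψ, hΨ, hΨΦ⟩ := exists_differentiable_extension_of_finite hS hΦ fun z _ => hbdd z
  refine ⟨Ψ, hΨ, congrFun (Continuous.ext_on hdense (G.continuous.comp hΨ.continuous)
    F.continuous fun y hy => ?_)⟩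
  rw [hΨΦ hy, h y hy]

theorem tendsto_cobounded_of_eval {α : Type*} {l : Filter α} {u : α → ℂ}
    (h : Tendsto (fun a => G.eval (u a)) l (Bornology.cobounded ℂ)) :
    Tendsto u l (Bornology.cobounded ℂ) := by
  rw [Metric.cobounded_eq_cocompact] at h ⊢
  exact h.of_tendsto_comp (comap_cocompact_le G.continuous)

theorem isBigO_id_of_eval_comp (hFd : 0 < F.natDegree) (hdeg : F.natDegree = G.natDegree)
    (h : ∀ z, G.eval (Φ z) = F.eval z) : Φ =O[Bornology.cobounded ℂ] (fun z => z) := by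
  have hF : Tendsto F.eval (Bornology.cobounded ℂ) (Bornology.cobounded ℂ) :=
    tendsto_norm_atTop_iff_cobounded.1
      (F.tendsto_norm_atTop (natDegree_pos_iff_degree_pos.1 hFd) tendsto_norm_cobounded_atTop)
  have hΦ : Tendsto Φ (Bornology.cobounded ℂ) (Bornology.cobounded ℂ) :=
    tendsto_cobounded_of_eval (G := G) (by simpa only [h] using hF)
  have hFO : F.eval =O[Bornology.cobounded ℂ] (fun z => z ^ F.natDegree) := by
    simpa using F.isBigO_cobounded_of_degree_le (Q := X ^ F.natDegree)
      (by simp [degree_le_natDegree])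
  have hGO : (fun z => z ^ F.natDegree) =O[Bornology.cobounded ℂ] G.eval := by
    simpa using isBigO_cobounded_of_degree_le (P := X ^ F.natDegree) (Q := G)
      (by rw [degree_X_pow, hdeg, degree_eq_natDegree (ne_zero_of_natDegree_gt (hdeg ▸ hFd))])
  have hpow : (fun z => Φ z ^ F.natDegree) =O[Bornology.cobounded ℂ] (fun z => z ^ F.natDegree) :=
    ((hGO.comp_tendsto hΦ).congr_right h).trans hFO
  exact hpow.of_pow hFd.ne'

theorem affineIso_of_eval_comp (hFd : 0 < F.natDegree) (hdeg : F.natDegree = G.natDegree)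
    (hΦ : Differentiable ℂ Φ) (h : ∀ z, G.eval (Φ z) = F.eval z) : AffineIso F G := by
  obtain ⟨a, b, hab⟩ := exists_eq_smul_add_of_isBigO_id hΦ (isBigO_id_of_eval_comp hFd hdeg h)
  have hFG : F = G.comp (C a * X + C b) := by
    refine Polynomial.funext fun z => ?_
    rw [← h z, hab z]
    simp only [eval_comp, eval_add, eval_mul, eval_C, eval_X, smul_eq_mul, mul_comm z]
  refine ⟨a, b, ?_, hFG⟩
  rintro rfl
  rw [C_0, zero_mul, zero_add, comp_C] at hFG
  rw [hFG, natDegree_C] at hFd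
  exact lt_irrefl _ hFd

end EntireLift

/-! ### Gluing the sheets -/

/-- A map `j` from the edges of `F` to the edges of `G` that commutes with the monodromy around `0`
and, passing to `1 - F` and `1 - G`, with the monodromy around `1`. -/
structure IsMonodromyHom (F G : ℂ[X]) (j : Set ℂ → Set ℂ) : Prop where
  mapsTo : Set.MapsTo j (dessin F).edges (dessin G).edges
  map_zero : ∀ {e e'}, MonodromyNext F e e' → MonodromyNext G (j e) (j e')
  map_one : ∀ {e e'}, MonodromyNext (1 - F) e e' → MonodromyNext (1 - G) (j e) (j e')

/-- On each sheet of `F`, the map `φ` is the passage to the corresponding sheet of `G`. -/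
def Intertwines (F G : ℂ[X]) (j : Set ℂ → Set ℂ) (φ : ℂ → ℂ) : Prop :=
  ∀ ⦃e s t⦄, IsSheet F e s → IsSheet G (j e) t → ∀ w ∈ doubleSlit, φ (s w) = t w

section Gluing

variable {F G : ℂ[X]} {j : Set ℂ → Set ℂ} {φ : ℂ → ℂ} {z : ℂ}

theorem Intertwines.one_sub (h : Intertwines F G j φ) : Intertwines (1 - F) (1 - G) j φ := by
  intro e s t hs ht w hw
  simpa using h hs.of_one_sub ht.of_one_sub (1 - w) (one_sub_mem_doubleSlit hw)

theorem exists_intertwines (hF : criticalValues F ⊆ {0, 1}) (hG : criticalValues G ⊆ {0, 1})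
    (j : Set ℂ → Set ℂ) : ∃ φ, Intertwines F G j φ := by
  have hpoint : ∀ y : ℂ, ∃ c : ℂ, ∀ e s t, IsSheet F e s → IsSheet G (j e) t →
      ∀ w ∈ doubleSlit, s w = y → c = t w := by
    intro y
    by_cases h : ∃ e s t w, IsSheet F e s ∧ IsSheet G (j e) t ∧ w ∈ doubleSlit ∧ s w = y
    · obtain ⟨e, s, t, w, hs, ht, hw, rfl⟩ := h
      refine ⟨t w, fun e' s' t' hs' ht' w' hw' hy' => ?_⟩
      obtain rfl : w' = w := by rw [← hs.eval_apply w hw, ← hs'.eval_apply w' hw', hy']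
      obtain rfl := hs.edge_eq hF hs' hw hy'.symm
      exact ht.eqOn hG ht' hw
    · exact ⟨0, fun e s t hs ht w hw hy => absurd ⟨e, s, t, w, hs, ht, hw, hy⟩ h⟩
  choose φ hφ using hpoint
  exact ⟨φ, fun e s t hs ht w hw => hφ (s w) e s t hs ht w hw rfl⟩

theorem Intertwines.apply_eq (hφ : Intertwines F G j φ) {e : Set ℂ} {s t : ℂ → ℂ}
    (hs : IsSheet F e s) (ht : IsSheet G (j e) t) (hz : F.eval z ∈ doubleSlit)
    (hsz : s (F.eval z) = z) : φ z = t (F.eval z) := by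
  simpa only [hsz] using hφ hs ht _ hz

theorem Intertwines.eval_eq (hF : criticalValues F ⊆ {0, 1}) (hG : criticalValues G ⊆ {0, 1})
    (hj : Set.MapsTo j (dessin F).edges (dessin G).edges) (hφ : Intertwines F G j φ)
    (hz : F.eval z ∈ doubleSlit) : G.eval (φ z) = F.eval z := by
  obtain ⟨e, s, hs, hsz⟩ := exists_isSheet_apply_eval hF hz
  obtain ⟨t, ht⟩ := exists_isSheet_of_mem_edges hG (hj hs.mem_edges)
  rw [hφ.apply_eq hs ht hz hsz, ht.eval_apply _ hz]

theorem IsBranch.eventually_differentiableAt_comp {T : Set ℂ} {t : ℂ → ℂ} (ht : IsBranch G T t)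
    (hT : IsOpen T) (hr : T ⊆ regularValues G) (hz : F.eval z ∈ T) :
    ∀ᶠ y in 𝓝 z, DifferentiableAt ℂ (fun y => t (F.eval y)) y := by
  filter_upwards [(hT.preimage F.continuous).mem_nhds hz] with y hy
  exact (ht.differentiableAt hT hr hy).comp y F.differentiable.differentiableAt

theorem Intertwines.extendsAt_of_mem_doubleSlit (hF : criticalValues F ⊆ {0, 1})
    (hG : criticalValues G ⊆ {0, 1}) (hj : Set.MapsTo j (dessin F).edges (dessin G).edges)
    (hφ : Intertwines F G j φ) (hz : F.eval z ∈ doubleSlit) :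
    ExtendsAt ℂ (F.eval ⁻¹' doubleSlit) φ z := by
  obtain ⟨e, s, hs, hsz⟩ := exists_isSheet_apply_eval hF hz
  obtain ⟨t, ht⟩ := exists_isSheet_of_mem_edges hG (hj hs.mem_edges)
  refine ⟨fun y => t (F.eval y), ht.toIsBranch.eventually_differentiableAt_comp
    isOpen_doubleSlit (doubleSlit_subset_regularValues hG) hz, ?_⟩
  filter_upwards [hs.toIsBranch.eventually_apply_eval isOpen_doubleSlit
    (doubleSlit_subset_regularValues hF) hz hsz] with y hy hyS
  exact hφ.apply_eq hs ht hyS hy.2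

theorem mem_upperHalf_or_mem_lowerHalf {w : ℂ} (hw : w ∈ doubleSlit) (hw' : w ∈ posSlit) :
    w ∈ upperHalf ∨ w ∈ lowerHalf := by
  have him : w.im ≠ 0 := by
    rcases hw with h | h
    · exact h
    · exact hw'.resolve_right h.1.not_gt
  exact him.lt_or_gt.symm

/-- Above the cut of `posSlit` the extension is glued from the sheets of `e`, below it from those of
the next edge `e'`; they fit together because `j e'` is the edge next to `j e`. -/
theorem Intertwines.extendsAt_of_mem_posSlit (hF : criticalValues F ⊆ {0, 1})
    (hG : criticalValues G ⊆ {0, 1})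
    (hj : ∀ {e e'}, MonodromyNext F e e' → MonodromyNext G (j e) (j e'))
    (hφ : Intertwines F G j φ) (hz : F.eval z ∈ posSlit) :
    ExtendsAt ℂ (F.eval ⁻¹' doubleSlit) φ z := by
  obtain ⟨s, hs, hsz⟩ := exists_isBranch isOpen_posSlit (posSlit_subset_regularValues hF) hz
  obtain ⟨e, e', hcross⟩ := hs.exists_crosses hF
  obtain ⟨s₁, h₁, hss₁⟩ := hcross.exists_upper
  obtain ⟨s₂, h₂, hss₂⟩ := hcross.exists_lower
  obtain ⟨t, ht⟩ := hj ⟨s, hcross⟩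
  obtain ⟨t₁, h₁', htt₁⟩ := ht.exists_upper
  obtain ⟨t₂, h₂', htt₂⟩ := ht.exists_lower
  refine ⟨fun y => t (F.eval y), ht.toIsBranch.eventually_differentiableAt_comp isOpen_posSlit
    (posSlit_subset_regularValues hG) hz, ?_⟩
  filter_upwards [hs.eventually_apply_eval isOpen_posSlit (posSlit_subset_regularValues hF) hz hsz]
    with y hy hyS
  rcases mem_upperHalf_or_mem_lowerHalf hyS hy.1 with hw | hw
  · rw [htt₁ hw]
    exact hφ.apply_eq h₁ h₁' hyS ((hss₁ hw).symm.trans hy.2)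
  · rw [htt₂ hw]
    exact hφ.apply_eq h₂ h₂' hyS ((hss₂ hw).symm.trans hy.2)

theorem Intertwines.extendsAt (hF : criticalValues F ⊆ {0, 1}) (hG : criticalValues G ⊆ {0, 1})
    (hj : IsMonodromyHom F G j) (hφ : Intertwines F G j φ) (hz : F.eval z ∉ ({0, 1} : Set ℂ)) :
    ExtendsAt ℂ (F.eval ⁻¹' doubleSlit) φ z := by
  rcases mem_slits_of_notMem_pair hz with h | h | h
  · exact hφ.extendsAt_of_mem_doubleSlit hF hG hj.mapsTo h
  · exact hφ.extendsAt_of_mem_posSlit hF hG hj.map_zero h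
  · refine (hφ.one_sub.extendsAt_of_mem_posSlit (criticalValues_one_sub_subset hF)
      (criticalValues_one_sub_subset hG) hj.map_one (by simpa using h)).mono fun y hy => ?_
    simpa using one_sub_mem_doubleSlit hy

theorem dense_doubleSlit : Dense doubleSlit := by
  intro w
  by_cases hw : w.im = 0
  · refine Metric.mem_closure_iff.2 fun ε hε =>
      ⟨w + (ε / 2 : ℝ) * Complex.I, Or.inl (by simpa [hw] using hε.ne'), ?_⟩
    rw [dist_self_add_right, norm_mul, Complex.norm_I, mul_one, Complex.norm_real,
      Real.norm_of_nonneg (half_pos hε).le]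
    exact half_lt_self hε
  · exact subset_closure (Or.inl hw)

theorem mem_closure_preimage {V : Set ℂ} (hV : Dense V) (hz : F.eval z ∈ regularValues F) :
    z ∈ closure (F.eval ⁻¹' V) := by
  have hderiv : F.derivative.eval z ≠ 0 := fun h => hz (eval_mem_criticalValues h)
  have hfreq := mem_closure_iff_frequently.1 (hV (F.eval z))
  rw [← (F.hasStrictDerivAt z).map_nhds_eq hderiv, frequently_map] at hfreq
  exact mem_closure_iff_frequently.2 hfreq

theorem finite_preimage_pair (hFd : 0 < F.natDegree) : (F.eval ⁻¹' {0, 1}).Finite :=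
  (finite_setOf_eval_eq hFd 0).union (finite_setOf_eval_eq hFd 1)

theorem exists_differentiableOn_lift (hF : criticalValues F ⊆ {0, 1})
    (hG : criticalValues G ⊆ {0, 1}) (hFd : 0 < F.natDegree) (hj : IsMonodromyHom F G j) :
    ∃ Φ : ℂ → ℂ, DifferentiableOn ℂ Φ (F.eval ⁻¹' {0, 1})ᶜ ∧
      ∀ z ∉ F.eval ⁻¹' {0, 1}, G.eval (Φ z) = F.eval z := by
  obtain ⟨φ, hφ⟩ := exists_intertwines hF hG j
  have hopen : IsOpen (F.eval ⁻¹' {0, 1})ᶜ := (finite_preimage_pair hFd).isClosed.isOpen_compl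
  have hclosure : (F.eval ⁻¹' {0, 1})ᶜ ⊆ closure (F.eval ⁻¹' doubleSlit) :=
    fun z hz => mem_closure_preimage dense_doubleSlit fun h => hz (hF h)
  obtain ⟨Φ, hΦ, hΦφ⟩ := exists_differentiableOn_extension hclosure hopen
    fun z hz => hφ.extendsAt hF hG hj hz
  refine ⟨Φ, hΦ, fun z hz => ?_⟩
  refine eq_of_eventuallyEq_nhdsWithin (G.continuous.continuousAt.comp
    (hΦ.differentiableAt (hopen.mem_nhds hz)).continuousAt) F.continuous.continuousAt
    (hclosure hz) ?_
  filter_upwards [self_mem_nhdsWithin, nhdsWithin_le_nhds (hopen.mem_nhds hz)] with y hy hyU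
  rw [Function.comp_apply, hΦφ ⟨hy, hyU⟩, hφ.eval_eq hF hG hj.mapsTo hy]

theorem IsMonodromyHom.affineIso (hF : criticalValues F ⊆ {0, 1})
    (hG : criticalValues G ⊆ {0, 1}) (hFd : 0 < F.natDegree) (hdeg : F.natDegree = G.natDegree)
    (hj : IsMonodromyHom F G j) : AffineIso F G := by
  obtain ⟨Φ, hΦ, hlift⟩ := exists_differentiableOn_lift hF hG hFd hj
  obtain ⟨Ψ, hΨ, hΨF⟩ := exists_differentiable_lift (hdeg ▸ hFd) (finite_preimage_pair hFd) hΦ hlift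
  exact affineIso_of_eval_comp hFd hdeg hΨ hΨF

end Gluing

/-! ### Isomorphic dessins -/

section Isomorphic

variable {F G : ℂ[X]}

theorem ncard_setOf_eval_eq {c : ℂ} (hFd : 0 < F.natDegree) (hc : c ∈ regularValues F) :
    {z | F.eval z = c}.ncard = F.natDegree := by
  have hne := sub_C_ne_zero hFd c
  have hnodup : (F - C c).roots.Nodup := by
    refine Multiset.nodup_iff_count_le_one.2 fun z => ?_
    rw [count_roots]
    by_contra hlt
    obtain ⟨hz, hz'⟩ := (one_lt_rootMultiplicity_iff_isRoot hne).1 (not_le.1 hlt)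
    have hFz : F.eval z = c := by simpa [sub_eq_zero] using hz
    exact hc ⟨z, by simpa [criticalPoints] using hz', hFz⟩
  have hroots : {z | F.eval z = c} = ((F - C c).roots.toFinset : Set ℂ) := by
    ext z
    simp [hne, sub_eq_zero]
  rw [hroots, Set.ncard_coe_finset, Multiset.toFinset_card_of_nodup hnodup,
    ← (IsAlgClosed.splits (F - C c)).natDegree_eq_card_roots, natDegree_sub_C]

/-- Each edge contains exactly one preimage of `1 / 2`. -/
theorem ncard_edges_eq_natDegree (hF : criticalValues F ⊆ {0, 1}) (hFd : 0 < F.natDegree) :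
    (dessin F).edges.ncard = F.natDegree := by
  have hslit : ((1 / 2 : ℝ) : ℂ) ∈ doubleSlit := ofReal_mem_doubleSlit half_mem_Ioo
  have hmem : ∀ {z}, F.eval z = ((1 / 2 : ℝ) : ℂ) → z ∈ openSegmentPreimage F :=
    fun hz => ⟨_, half_mem_Ioo, hz⟩
  rw [← ncard_setOf_eval_eq hFd (doubleSlit_subset_regularValues hF hslit), eq_comm]
  refine Set.ncard_congr (fun z _ => connectedComponentIn (openSegmentPreimage F) z)
    (fun z hz => ⟨z, hmem hz, rfl⟩) (fun z z' hz hz' h => ?_) (fun e he => ?_)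
  · obtain ⟨s, hs⟩ := exists_isSheet_of_mem_edges hF ⟨z, hmem hz, rfl⟩
    have hsz := hs.apply_eval hF (mem_connectedComponentIn (hmem hz))
    have hsz' := hs.apply_eval hF (h ▸ mem_connectedComponentIn (hmem hz'))
    rw [← hsz, ← hsz', show F.eval z = _ from hz, show F.eval z' = _ from hz']
  · obtain ⟨s, hs⟩ := exists_isSheet_of_mem_edges hF he
    have hsc := hs.eval_apply _ hslit
    exact ⟨_, hsc, edge_eq_of_mem ⟨_, hmem hsc, rfl⟩ he (mem_connectedComponentIn (hmem hsc))
      (hs.mem_edge _ half_mem_Ioo)⟩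

theorem one_sub_ne_zero_of_natDegree_pos (hFd : 0 < F.natDegree) : 1 - F ≠ 0 := by
  rw [← neg_sub, neg_ne_zero, ← C_1]
  exact sub_C_ne_zero hFd 1

open Classical in
/-- The action of an isomorphism of drawings on edges, extended by the identity to all sets. -/
def PlaneDrawing.Iso.edgeMap {D D' : PlaneDrawing} (i : D.Iso D') (e : Set ℂ) : Set ℂ :=
  if he : e ∈ D.edges then i.onEdges ⟨e, he⟩ else e

theorem PlaneDrawing.Iso.edgeMap_of_mem {D D' : PlaneDrawing} (i : D.Iso D') {e : Set ℂ}
    (he : e ∈ D.edges) : i.edgeMap e = i.onEdges ⟨e, he⟩ :=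
  dif_pos he

theorem PlaneDrawing.Iso.mapsTo_edgeMap {D D' : PlaneDrawing} (i : D.Iso D') :
    Set.MapsTo i.edgeMap D.edges D'.edges := fun e he => by
  rw [i.edgeMap_of_mem he]
  exact (i.onEdges ⟨e, he⟩).2

theorem isMonodromyHom_edgeMap (hF : criticalValues F ⊆ {0, 1}) (hG : criticalValues G ⊆ {0, 1})
    (hFd : 0 < F.natDegree) (hGd : 0 < G.natDegree) (i : (dessin F).Iso (dessin G)) :
    IsMonodromyHom F G i.edgeMap where
  mapsTo := i.mapsTo_edgeMap
  map_zero := by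
    refine MonodromyNext.map_of_ccwNext hF hG (ne_zero_of_natDegree_gt hFd)
      (ne_zero_of_natDegree_gt hGd) i.mapsTo_edgeMap fun v hv => ?_
    refine ⟨i.onBlack ⟨v, hv⟩, (i.onBlack ⟨v, hv⟩).2, fun e he e' he' h => ?_⟩
    rw [i.edgeMap_of_mem he, i.edgeMap_of_mem he']
    exact (i.ccw_black ⟨v, hv⟩ ⟨e, he⟩ ⟨e', he'⟩).1 h
  map_one := by
    refine MonodromyNext.map_of_ccwNext (criticalValues_one_sub_subset hF)
      (criticalValues_one_sub_subset hG) (one_sub_ne_zero_of_natDegree_pos hFd)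
      (one_sub_ne_zero_of_natDegree_pos hGd) (by simpa only [edges_one_sub] using i.mapsTo_edgeMap)
      fun v hv => ?_
    have hv' : v ∈ (dessin F).white := mem_black_one_sub.1 hv
    refine ⟨i.onWhite ⟨v, hv'⟩, mem_black_one_sub.2 (i.onWhite ⟨v, hv'⟩).2, ?_⟩
    simp only [edges_one_sub, ccwNext_one_sub]
    intro e he e' he' h
    rw [i.edgeMap_of_mem he, i.edgeMap_of_mem he']
    exact (i.ccw_white ⟨v, hv'⟩ ⟨e, he⟩ ⟨e', he'⟩).1 h

theorem affineIso_of_isomorphic (hF : criticalValues F ⊆ {0, 1}) (hG : criticalValues G ⊆ {0, 1})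
    (hFd : 0 < F.natDegree) (hGd : 0 < G.natDegree)
    (h : (dessin F).Isomorphic (dessin G)) : AffineIso F G := by
  obtain ⟨i⟩ := h
  have hdeg : F.natDegree = G.natDegree := by
    rw [← ncard_edges_eq_natDegree hF hFd, ← ncard_edges_eq_natDegree hG hGd]
    exact Nat.card_congr i.onEdges
  exact (isMonodromyHom_edgeMap hF hG hFd hGd i).affineIso hF hG hFd hdeg

theorem PlaneDrawing.Isomorphic.refl (D : PlaneDrawing) : D.Isomorphic D :=
  ⟨⟨Equiv.refl _, Equiv.refl _, Equiv.refl _, fun _ _ => Iff.rfl, fun _ _ => Iff.rfl,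
    fun _ _ _ => Iff.rfl, fun _ _ _ => Iff.rfl⟩⟩

end Isomorphic

end BelyiDessin

theorem theorem3p4 :
    ∃ hcomp : ∀ f g : Polynomial ℂ, BelyiDessin.IsExtraClean f → BelyiDessin.IsExtraClean g →
        BelyiDessin.IsExtraClean (f.comp g),
      (∀ f g : Polynomial ℂ, BelyiDessin.IsExtraClean f → BelyiDessin.IsExtraClean g →
        ((BelyiDessin.dessin (f.comp f)).Isomorphic (BelyiDessin.dessin (g.comp g)) ↔ f = g)) ∧
      Function.Injective (BelyiDessin.secondIterateClass hcomp) ∧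
      ∀ (σ : BelyiDessin.AbsGal) (f : BelyiDessin.XDBP),
        BelyiDessin.secondIterateClass hcomp (σ • f) =
          σ • BelyiDessin.secondIterateClass hcomp f := by
  refine ⟨fun f g hf hg => hf.comp hg, fun f g hf hg => ⟨fun h => ?_, ?_⟩, fun f g h => ?_,
    fun σ f => ?_⟩
  · have hff := (hf.comp hf).toIsBelyi
    have hgg := (hg.comp hg).toIsBelyi
    exact hf.eq_of_affineIso hg (BelyiDessin.affineIso_of_isomorphic hff.criticalValues_subset
      hgg.criticalValues_subset hff.natDegree_pos hgg.natDegree_pos h)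
  · rintro rfl
    exact BelyiDessin.PlaneDrawing.Isomorphic.refl _
  · have hiso : BelyiDessin.AffineIso (BelyiDessin.toC (f.1.comp f.1))
        (BelyiDessin.toC (g.1.comp g.1)) := Quotient.exact h
    rw [BelyiDessin.toC_comp, BelyiDessin.toC_comp] at hiso
    exact Subtype.ext (BelyiDessin.toC_injective (f.2.eq_of_affineIso g.2 hiso))
  · exact congrArg (Quotient.mk BelyiDessin.bpSetoid)
      (Subtype.ext (BelyiDessin.twist_comp σ f.1 f.1).symm)
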